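/- Let $d\ge 1$ and let $(\Lambda_n)_{n\ge1}$ be finite subsets of $\mathbb Z^d$, each containing the origin $\mathbf 0$ and connected in the nearest-neighbour graph of $\mathbb Z^d$, with $|\Lambda_n|\to\infty$. Let $I_n=\{\{i,j\}: i,j\in\Lambda_n,\ \|i-j\|_1=1\}$ be the set of bonds of $\Lambda_n$. The parameter space is $$\mathcal S_n=\{\sigma\in\{+1,-1\}^{\Lambda_n}:\sigma_{\mathbf 0}=+1\},$$ with the metric $$d_n(\sigma,\sigma')=\Big(\frac1{|\Lambda_n|}\sum_{\{i,j\}\in I_n}(\sigma_i\sigma_j-\sigma'_i\sigma'_j)^2\Big)^{1/2}.$$ The Edwards–Anderson problem with disorder $x\in\mathbb R^{I_n}$ is to minimize $\mathcal H_n(x;\sigma)=-\sum_{\{i,j\}\in I_n}x_{\{i,j\}}\sigma_i\sigma_j$ over $\sigma\in\mathcal S_n$. Let $\mathcal P$ be a probability measure on $\mathbb R$ that is integrable with mean zero and has a density $f$ with the following property: for every $p\ge0$ there is $C(f,p)\in(0,\infty)$ such that, for independent $X\sim\mathcal P$ and $W\sim N(0,1)$, $$\mathbb E\Big[|W|^p\Big(1-\frac{f(X+sW)}{f(X)}\Big)_+\Big]\le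 C(f,p)\,s\qquad\text{for all } s\ge0 .$$ Then for every $n$ and $\mathcal P^{\otimes I_n}$-almost every $x$ the minimizer $\widehat\sigma_n(x)\in\mathcal S_n$ of $\mathcal H_n(x;\cdot)$ is unique, and the sequence of minimization problems with i.i.d. disorder of law $\mathcal P$ is stable under small perturbations for each of the following two choices of perturbation blocks $J_{n,l}\subseteq I_n$, $l\in\mathcal L_n$: 1. $\mathcal L_n=I_n$ and $J_{n,\{i,j\}}=\{\{i,j\}\}$ (one bond is replaced); 2. $\mathcal L_n=\Lambda_n$ and $J_{n,i}=\{\{i,j\}: j\in\Lambda_n,\ \|j-i\|_1=1\}$ (all bonds at one site are replaced). Here stability means the following. Let $\mathbf X^n\sim\mathcal P^{\otimes I_n}$ and, for each $l\in\mathcal L_n$, let $\mathbf X^{n,l}$ be an independent copy of $\mathbf X^n$ (the joint law of $\mathbf X^n$ and all the copies $\mathbf X^{n,l}$, $l\in\mathcal L_n$, is otherwise arbitrary). Let $\mathbf X^n_l$ be obtained from $\mathbf X^n$ by replacing the coordinates in $J_{n,l}$ by those of $\mathbf X^{n,l}$. Then for all $\varepsilon,\delta>0$ there is $M<\infty$ such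 that $$\limsup_{n\to\infty}\mathbb P\Big[\min_{A\subseteq\mathcal L_n:\,|A|>(1-\varepsilon)|\mathcal L_n|}P\big(\{\widehat\sigma_n(\mathbf X^n_l):l\in A\},d_n,\varepsilon\big)\ge M\Big]\le\delta,$$ where $P(T,d_n,\varepsilon)$ is the largest cardinality of a subset of $T$ whose distinct points are at $d_n$-distance greater than $\varepsilon$. -/

import Mathlib

open MeasureTheory ProbabilityTheory Filter
open scoped NNReal ENNReal

/-! ### Stability of sequences of random minimization problems -/

namespace RandomMinimization

/-- `s` minimizes the objective function `h` over the parameter space. -/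
def IsMinimizer {S : Type*} (h : S → ℝ) (s : S) : Prop := ∀ s' : S, h s ≤ h s'

/-- The minimizer of `ψ x` is unique for almost every input `x`, when the coordinates of `x` are
i.i.d. with law `P`. -/
def HasUniqueMinimizer {𝒳 I S : Type*} [MeasurableSpace 𝒳] [Fintype I] (P : Measure 𝒳)
    (ψ : (I → 𝒳) → S → ℝ) : Prop :=
  ∀ᵐ x ∂(Measure.pi fun _ : I => P), ∃! s : S, IsMinimizer (ψ x) s

open Classical in
/-- The input obtained from `x` by replacing the coordinates in the block `J` by those of `x'`. -/
noncomputable def replaceBlock {𝒳 I : Type*} (J : Set I) (x x' : I → 𝒳) : I → 𝒳 :=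
  fun i => if i ∈ J then x' i else x i

open Classical in
/-- The least `ε`-packing number of a set `{o l : l ∈ A}`, over all sets `A` of labels that contain
more than a proportion `1 - ε` of all labels. -/
noncomputable def trimmedPackingNumber {L S : Type*} [Fintype L] [PseudoMetricSpace S]
    (ε : ℝ≥0) (o : L → S) : ℕ∞ :=
  ⨅ (A : Finset L) (_ : (1 - (ε : ℝ)) * (Fintype.card L : ℝ) < (A.card : ℝ)),
    Metric.packingNumber ε (o '' (A : Set L))

/-- Stability under small perturbations, for the sequence of problems
"minimize `ψ n x` over `S n`" with perturbation blocks `J n l`, `l : L n`.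

The input `X n` has i.i.d. coordinates with law `P`, and for each label `l` the vector `X' n l` is
an independent copy of `X n`; nothing else is assumed on their joint law. The map `opt n` is the
optimizer, determined by its value at almost every input. -/
def StableUnderSmallPerturbations.{u, v, w, z, y} {𝒳 : Type v} [MeasurableSpace 𝒳]
    (P : Measure 𝒳)
    {I : ℕ → Type w} [∀ n, Fintype (I n)]
    {S : ℕ → Type z} [∀ n, PseudoMetricSpace (S n)]
    (ψ : ∀ n, (I n → 𝒳) → S n → ℝ)
    {L : ℕ → Type y} [∀ n, Fintype (L n)]
    (J : ∀ n, L n → Set (I n)) : Prop :=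
  ∀ (Ω : ℕ → Type u) [∀ n, MeasurableSpace (Ω n)]
    (μ : ∀ n, Measure (Ω n)) [∀ n, IsProbabilityMeasure (μ n)]
    (X : ∀ n, Ω n → I n → 𝒳) (X' : ∀ n, L n → Ω n → I n → 𝒳)
    (opt : ∀ n, (I n → 𝒳) → S n),
    (∀ n, HasLaw (X n) (Measure.pi fun _ => P) (μ n)) →
    (∀ n l, HasLaw (X' n l) (Measure.pi fun _ => P) (μ n)) →
    (∀ n l, IndepFun (X n) (X' n l) (μ n)) →
    (∀ n, ∀ᵐ x ∂(Measure.pi fun _ : I n => P), IsMinimizer (ψ n x) (opt n x)) →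
    ∀ ε δ : ℝ≥0, 0 < ε → 0 < δ → ∃ M : ℕ,
      limsup (fun n => μ n {ω | (M : ℕ∞) ≤ trimmedPackingNumber ε
        (fun l : L n => opt n (replaceBlock (J n l) (X n ω) (X' n l ω)))}) atTop ≤ (δ : ℝ≥0∞)

/-- The regularity assumption on a law `P` on the real line: `P` has a density `f` such that, for
independent `X ∼ P` and `W ∼ N(0, 1)` and all `p ≥ 0`,
`𝔼 [|W| ^ p * (1 - f (X + s * W) / f X)₊] ≤ C(f, p) * s` for all `s ≥ 0`. -/
def HasRegularDensity (P : Measure ℝ) : Prop :=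
  ∃ f : ℝ → ℝ, Measurable f ∧ (∀ x, 0 ≤ f x) ∧
    P = volume.withDensity (fun x => ENNReal.ofReal (f x)) ∧
    ∀ p : ℝ, 0 ≤ p → ∃ C : ℝ, 0 < C ∧ ∀ s : ℝ, 0 ≤ s →
      ∫⁻ z : ℝ × ℝ, ENNReal.ofReal (|z.2| ^ p * max (1 - f (z.1 + s * z.2) / f z.1) 0)
        ∂(P.prod (gaussianReal 0 1)) ≤ ENNReal.ofReal (C * s)

end RandomMinimization

/-! ### The Edwards–Anderson model -/

namespace EdwardsAnderson

/-- The nearest-neighbour graph on `ℤ^d`: `i` and `j` are adjacent when `‖i - j‖₁ = 1`. -/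
def latticeGraph (d : ℕ) : SimpleGraph (Fin d → ℤ) where
  Adj i j := ∑ k, |i k - j k| = 1
  symm := ⟨fun i j h => by simpa only [abs_sub_comm] using h⟩
  loopless := ⟨fun i h => by simp at h⟩

/-- A finite region of `ℤ^d` that contains the origin and is connected in the lattice. -/
structure Box (d : ℕ) where
  sites : Finset (Fin d → ℤ)
  zero_mem : (0 : Fin d → ℤ) ∈ sites
  connected : ((latticeGraph d).induce (sites : Set (Fin d → ℤ))).Connected

variable {d : ℕ}

/-- The sites of the region, as a type. -/
abbrev Site (Λ : Box d) : Type := (Λ.sites : Set (Fin d → ℤ))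

/-- The nearest-neighbour graph of the region. -/
def Box.graph (Λ : Box d) : SimpleGraph (Site Λ) :=
  (latticeGraph d).induce (Λ.sites : Set (Fin d → ℤ))

/-- The bonds of the region: unordered pairs of nearest neighbours. -/
abbrev Bond (Λ : Box d) : Type := Λ.graph.edgeSet

noncomputable instance (Λ : Box d) : Fintype (Bond Λ) := Fintype.ofFinite _

/-- Spin configurations with values in `{+1, -1}`, with spin `+1` at the origin. -/
@[ext]
structure SpinConfig (Λ : Box d) where
  spin : Site Λ → ℤˣ
  spin_zero : spin ⟨0, Λ.zero_mem⟩ = 1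

/-- The product `σ_i σ_j` over the bond `{i, j}`, as a real number. -/
def bondSpin {Λ : Box d} (σ : SpinConfig Λ) (b : Bond Λ) : ℝ :=
  Sym2.lift ⟨fun i j => ((σ.spin i : ℤ) : ℝ) * ((σ.spin j : ℤ) : ℝ), fun _ _ => mul_comm _ _⟩ b.1

/-- The Edwards–Anderson Hamiltonian with disorder `x`. -/
noncomputable def hamiltonian (Λ : Box d) (x : Bond Λ → ℝ) (σ : SpinConfig Λ) : ℝ :=
  -∑ b, x b * bondSpin σ b

/-- The bond-overlap distance. -/
noncomputable def bondDist {Λ : Box d} (σ τ : SpinConfig Λ) : ℝ :=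
  √((1 / (Λ.sites.card : ℝ)) * ∑ b, (bondSpin σ b - bondSpin τ b) ^ 2)

theorem bondDist_eq_mul_dist {Λ : Box d} (σ τ : SpinConfig Λ) :
    bondDist σ τ = √(1 / (Λ.sites.card : ℝ)) *
      dist (WithLp.toLp 2 (bondSpin σ)) (WithLp.toLp 2 (bondSpin τ)) := by
  rw [bondDist, Real.sqrt_mul (by positivity), EuclideanSpace.dist_eq]
  simp [Real.dist_eq, sq_abs]

theorem bondSpin_injective {Λ : Box d} :
    Function.Injective (bondSpin : SpinConfig Λ → Bond Λ → ℝ) := by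
  intro σ τ h
  have hadj : ∀ i j, Λ.graph.Adj i j → σ.spin i = τ.spin i → σ.spin j = τ.spin j := by
    intro i j hij hi
    have hb := congrFun h ⟨s(i, j), hij⟩
    simp only [bondSpin, Sym2.lift_mk, hi] at hb
    have hb' : (τ.spin i * σ.spin j : ℤˣ) = τ.spin i * τ.spin j := by
      ext; push_cast; exact_mod_cast hb
    exact mul_left_cancel hb'
  have hwalk : ∀ i j (_ : Λ.graph.Walk i j), σ.spin i = τ.spin i → σ.spin j = τ.spin j := by
    intro i j w
    induction w with
    | nil => exact id
    | cons ha _ ih => exact fun hi => ih (hadj _ _ ha hi)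
  ext1
  funext j
  obtain ⟨w⟩ := Λ.connected.preconnected ⟨0, Λ.zero_mem⟩ j
  exact hwalk _ _ w (σ.spin_zero.trans τ.spin_zero.symm)

theorem card_sites_pos (Λ : Box d) : 0 < Λ.sites.card := Finset.card_pos.2 ⟨0, Λ.zero_mem⟩

/-- Spin configurations, metrized by the bond-overlap distance. -/
noncomputable instance (Λ : Box d) : MetricSpace (SpinConfig Λ) where
  dist := bondDist
  dist_self σ := by simp [bondDist]
  dist_comm σ τ := by simp only [bondDist_eq_mul_dist, dist_comm]
  dist_triangle σ τ ρ := by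
    simp only [bondDist_eq_mul_dist, ← mul_add]
    exact mul_le_mul_of_nonneg_left (dist_triangle _ _ _) (Real.sqrt_nonneg _)
  eq_of_dist_eq_zero {σ τ} h := by
    have h' : bondDist σ τ = 0 := h
    have hc : √(1 / (Λ.sites.card : ℝ)) ≠ 0 := by
      have : (0 : ℝ) < Λ.sites.card := by exact_mod_cast card_sites_pos Λ
      positivity
    rw [bondDist_eq_mul_dist, mul_eq_zero, or_iff_right hc, dist_eq_zero] at h'
    exact bondSpin_injective ((WithLp.toLp_injective 2) h')

/-- The perturbation block consisting of a single bond. -/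
def bondBlock (Λ : Box d) (b : Bond Λ) : Set (Bond Λ) := {b}

/-- The perturbation block consisting of all bonds at a site. -/
def siteBlock (Λ : Box d) (i : Site Λ) : Set (Bond Λ) := {b | i ∈ b.1}

end EdwardsAnderson

universe u

/-! The disorder is moved slightly in all coordinates at once, without changing its law. Each
coupling makes one Metropolis step with stationary law `P` and Gaussian proposal `s * w`, where `s =
|Λ|^(-1/2)`. If every proposal were accepted, the energy of a state `σ` would change by `-⟪s • φ σ,
w⟫`, with `φ σ` the vector of bond products. The canonical metric of this Gaussian field is exactly
the bond-overlap distance. The regularity of the density, with `p = 1`, bounds the mean rejected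
increment per bond by `C * s`, so the total energy error has mean at most `|I| * s ^ 2 * C`. This is
bounded because `|I| ≤ 3 ^ d * |Λ|`.

Since the law is preserved, the change of the minimal energy has mean zero. Testing the new energy
on the old minimizer involves a single Gaussian of bounded variance, so the positive part of the
change has bounded mean, and hence so does the negative part. If the old disorder had many separated
states within `K` of the minimum, a Sudakov-type minoration would make one of the Gaussians exceed a
large level `m` with probability at least one half. The minimal energy would then drop by `m - K`,
up to the rejection error. Such disorder is therefore unlikely, uniformly in the size of the system:
this is `exists_measure_isSeparatedNearMinimal_le`.

Replacing a block of bounded size changes every energy by at most the total change of the couplings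
in the block, which has bounded mean. By Markov's inequality, outside an event of small probability,
more than a proportion `1 - ε` of the perturbed minimizers are nearly minimal for the single
unperturbed disorder. They cannot then contain many separated points. Only the joint law of the
input with one copy at a time enters. Uniqueness holds because a tie between two states confines the
disorder to a hyperplane. -/

/-! ### Gaussian vectors and a dimension-free minoration -/

section Sudakov

variable {E : Type*} [NormedAddCommGroup E] [InnerProductSpace ℝ E] [FiniteDimensional ℝ E]
  [MeasurableSpace E] [BorelSpace E]

theorem hasGaussianLaw_inner_stdGaussian (u : E) :
    HasGaussianLaw (fun w => inner ℝ u w) (stdGaussian E) :=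
  IsGaussian.hasGaussianLaw_id.map_fun (innerSL ℝ u)

theorem variance_inner_stdGaussian (u : E) :
    Var[fun w => inner ℝ u w; stdGaussian E] = ‖u‖ ^ 2 := by
  have h := variance_dual_stdGaussian (innerSL ℝ u)
  rw [innerSL_apply_norm] at h
  exact h

theorem integral_inner_stdGaussian (u : E) : ∫ w, inner ℝ u w ∂(stdGaussian E) = 0 :=
  integral_strongDual_stdGaussian (innerSL ℝ u)

theorem map_inner_stdGaussian_of_norm_eq_one {u : E} (hu : ‖u‖ = 1) :
    (stdGaussian E).map (fun w => inner ℝ u w) = gaussianReal 0 1 := by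
  rw [(hasGaussianLaw_inner_stdGaussian u).map_eq_gaussianReal, variance_inner_stdGaussian,
    integral_inner_stdGaussian, hu]
  simp

omit [FiniteDimensional ℝ E] in
theorem measurable_inner_left (u : E) : Measurable (fun w : E => inner ℝ u w) :=
  (innerSL ℝ u).continuous.measurable

theorem integral_abs_inner_stdGaussian_le (u : E) :
    ∫⁻ w, ENNReal.ofReal |inner ℝ u w| ∂(stdGaussian E) ≤ ENNReal.ofReal ‖u‖ := by
  have hm := (hasGaussianLaw_inner_stdGaussian u).memLp_two
  have h1 : eLpNorm (fun w : E => inner ℝ u w) 1 (stdGaussian E) ≤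
      eLpNorm (fun w : E => inner ℝ u w) 2 (stdGaussian E) :=
    eLpNorm_le_eLpNorm_of_exponent_le (by norm_num) hm.aestronglyMeasurable
  have h2 : eLpNorm (fun w : E => inner ℝ u w) 2 (stdGaussian E) = ENNReal.ofReal ‖u‖ := by
    rw [hm.eLpNorm_eq_integral_rpow_norm (by norm_num) (by norm_num)]
    have hv := variance_inner_stdGaussian u
    rw [variance_of_integral_eq_zero hm.aemeasurable (integral_inner_stdGaussian u)] at hv
    simp only [ENNReal.toReal_ofNat, Real.rpow_ofNat, Real.norm_eq_abs, sq_abs]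
    rw [hv, ← one_div, ← Real.sqrt_eq_rpow, Real.sqrt_sq (norm_nonneg u)]
  rw [h2, eLpNorm_one_eq_lintegral_enorm] at h1
  simpa [← Real.enorm_eq_ofReal_abs] using h1

theorem gaussian_tail_le_of_le_norm {u : E} {c t : ℝ} (hc : 0 < c) (hu : c ≤ ‖u‖) (ht : 0 ≤ t) :
    (gaussianReal 0 1).real (Set.Ici (t / c)) ≤ (stdGaussian E).real {w | t ≤ inner ℝ u w} := by
  have hu0 : 0 < ‖u‖ := hc.trans_le hu
  have hn : ‖(‖u‖⁻¹ • u)‖ = 1 := by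
    rw [norm_smul, norm_inv, norm_norm, inv_mul_cancel₀ hu0.ne']
  rw [← map_inner_stdGaussian_of_norm_eq_one hn,
    map_measureReal_apply (measurable_inner_left _) measurableSet_Ici]
  refine measureReal_mono ?_
  intro w hw
  simp only [Set.mem_preimage, Set.mem_Ici, real_inner_smul_left, Set.mem_ofPred_eq] at hw ⊢
  have h1 : t / ‖u‖ ≤ t / c := by gcongr
  have h2 := h1.trans hw
  rwa [div_eq_inv_mul, mul_le_mul_iff_right₀ (inv_pos.2 hu0)] at h2

/-- Chebyshev's inequality: the variance is at most `R ^ 2` and the deviation is `2 * R`. -/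
theorem measureReal_inner_lt_le {p : E} {R : ℝ} (hR : 0 < R) (hp : ‖p‖ ≤ R) :
    (stdGaussian E).real {w | inner ℝ p w < -(2 * R)} ≤ 1 / 4 := by
  have h := meas_ge_le_variance_div_sq (hasGaussianLaw_inner_stdGaussian p).memLp_two
    (c := 2 * R) (by positivity)
  rw [variance_inner_stdGaussian, integral_inner_stdGaussian] at h
  have h2 : ‖p‖ ^ 2 / (2 * R) ^ 2 ≤ 1 / 4 := by
    rw [div_le_iff₀ (by positivity)]
    nlinarith [norm_nonneg p]
  have h3 : (stdGaussian E) {w | inner ℝ p w < -(2 * R)} ≤ ENNReal.ofReal (1 / 4) := by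
    refine (measure_mono ?_).trans (h.trans (ENNReal.ofReal_le_ofReal h2))
    intro w hw
    simp only [Set.mem_ofPred_eq, sub_zero] at hw ⊢
    exact le_abs.2 (Or.inr (by linarith))
  exact ENNReal.toReal_le_of_le_ofReal (by norm_num) h3

theorem indepFun_starProjection_stdGaussian (K : Submodule ℝ E) :
    IndepFun (fun w => K.starProjection w) (fun w => Kᗮ.starProjection w) (stdGaussian E) := by
  have hg : HasGaussianLaw (fun w => (K.starProjection w, Kᗮ.starProjection w)) (stdGaussian E) :=
    IsGaussian.hasGaussianLaw_id.map_fun (K.starProjection.prod Kᗮ.starProjection)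
  refine hg.indepFun_of_covariance_inner fun x y => ?_
  simp_rw [← Submodule.inner_starProjection_left_eq_right]
  rw [← covarianceBilin_apply_eq_cov IsGaussian.memLp_two_id, covarianceBilin_stdGaussian]
  exact Submodule.inner_right_of_mem_orthogonal (K.starProjection_apply_mem x)
    (Kᗮ.starProjection_apply_mem y)

/-- The hypothesis `hAK` says that `A` is a cylinder over `K`. The projections of a standard
Gaussian vector to `K` and to its orthogonal complement are jointly Gaussian and uncorrelated, hence
independent. -/
theorem measureReal_inter_inner_orthogonal (K : Submodule ℝ E) {u : E} (hu : u ∈ Kᗮ) {A : Set E}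
    (hA : MeasurableSet A) (hAK : ∀ w, w ∈ A ↔ K.starProjection w ∈ A) (t : ℝ) :
    (stdGaussian E).real (A ∩ {w | t ≤ inner ℝ u w}) =
      (stdGaussian E).real A * (stdGaussian E).real {w | t ≤ inner ℝ u w} := by
  have hB : MeasurableSet {w : E | t ≤ inner ℝ u w} :=
    measurableSet_le measurable_const (measurable_inner_left u)
  have h := (indepFun_starProjection_stdGaussian K).measure_inter_preimage_eq_mul _ _ hA hB
  have h1 : (fun w => K.starProjection w) ⁻¹' A = A := by
    ext w; exact (hAK w).symm
  have h2 : (fun w => Kᗮ.starProjection w) ⁻¹' {w : E | t ≤ inner ℝ u w} =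
      {w : E | t ≤ inner ℝ u w} := by
    ext w
    simp only [Set.mem_preimage, Set.mem_ofPred_eq]
    rw [← Submodule.inner_starProjection_left_eq_right, Submodule.starProjection_eq_self_iff.2 hu]
  rw [h1, h2] at h
  simp only [Measure.real, h, ENNReal.toReal_mul]

/-- If each of the vectors `v 0, …, v (k - 1)` keeps away from the span of its predecessors, then
with probability at least `1 / 2` one of the Gaussians `⟪v i, w⟫` exceeds a given level, as soon as
`k` is large. -/
theorem half_le_measureReal_of_sub_starProjection {R c m : ℝ} (hR : 0 < R) (hc : 0 < c)
    (hm : 0 ≤ m) {k : ℕ} (hk : 4 ≤ k * (gaussianReal 0 1).real (Set.Ici ((m + 2 * R) / c)))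
    (v : ℕ → E) (hv : ∀ i < k, ‖v i‖ ≤ R)
    (hvc : ∀ i < k,
      c ≤ ‖v i - (Submodule.span ℝ (v '' Set.Iio i)).starProjection (v i)‖) :
    1 / 2 ≤ (stdGaussian E).real {w | ∃ i < k, m ≤ inner ℝ (v i) w} := by
  set γ := stdGaussian E
  set q := (gaussianReal 0 1).real (Set.Ici ((m + 2 * R) / c))
  let N : ℕ → Set E := fun j => {w | ∀ i < j, inner ℝ (v i) w < m}
  have hNm : ∀ j, MeasurableSet (N j) := by
    intro j
    have : N j = ⋂ i, ⋂ (_ : i < j), {w | inner ℝ (v i) w < m} := by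
      ext w; simp [N]
    rw [this]
    exact MeasurableSet.iInter fun i => MeasurableSet.iInter fun _ =>
      measurableSet_lt (measurable_inner_left _) measurable_const
  have hanti : ∀ i j, i ≤ j → N j ⊆ N i := fun i j hij w hw l hl => hw l (hl.trans_le hij)
  -- Split `v j` into its projection `p` to the span of its predecessors and an orthogonal rest.
  -- Having stayed below `m` so far and `⟪p, w⟫ ≥ -2R` are events over the span. Independently of
  -- them, the rest exceeds `m + 2R` with probability at least `q`, and then `⟪v j, w⟫ ≥ m`. The
  -- loss `1 / 4` is the Chebyshev bound for `⟪p, w⟫`.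
  have hstep : ∀ j < k, q * (γ.real (N j) - 1 / 4) ≤ γ.real (N j) - γ.real (N (j + 1)) := by
    intro j hj
    set K := Submodule.span ℝ (v '' Set.Iio j)
    set p := K.starProjection (v j)
    have hpK : p ∈ K := K.starProjection_apply_mem _
    have huK : v j - p ∈ Kᗮ := K.sub_starProjection_mem_orthogonal _
    have hpR : ‖p‖ ≤ R := (K.norm_starProjection_apply_le _).trans (hv j hj)
    let A : Set E := N j ∩ {w | -(2 * R) ≤ inner ℝ p w}
    have hAm : MeasurableSet A :=
      (hNm j).inter (measurableSet_le measurable_const (measurable_inner_left _))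
    have hinner : ∀ x ∈ K, ∀ w, inner ℝ x (K.starProjection w) = inner ℝ x w := by
      intro x hx w
      rw [← Submodule.inner_starProjection_left_eq_right, Submodule.starProjection_eq_self_iff.2 hx]
    have hAK : ∀ w, w ∈ A ↔ K.starProjection w ∈ A := by
      intro w
      have h1 : ∀ i < j, inner ℝ (v i) (K.starProjection w) = inner ℝ (v i) w := fun i hi =>
        hinner _ (Submodule.subset_span ⟨i, hi, rfl⟩) w
      simp only [A, N, Set.mem_inter_iff, Set.mem_ofPred_eq, hinner p hpK w]
      refine and_congr_left fun _ => forall₂_congr fun i hi => ?_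
      rw [h1 i hi]
    have hA1 : γ.real (N j) - 1 / 4 ≤ γ.real A := by
      have h1 : N j ⊆ A ∪ {w | inner ℝ p w < -(2 * R)} := by
        intro w hw
        by_cases h : inner ℝ p w < -(2 * R)
        · exact Or.inr h
        · exact Or.inl ⟨hw, not_lt.1 h⟩
      have h2 := (measureReal_mono (μ := γ) h1).trans (measureReal_union_le _ _)
      have h3 := measureReal_inner_lt_le hR hpR
      linarith
    have hq : q ≤ γ.real {w | m + 2 * R ≤ inner ℝ (v j - p) w} :=
      gaussian_tail_le_of_le_norm hc (hvc j hj) (by positivity)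
    have hprod := measureReal_inter_inner_orthogonal K huK hAm hAK (m + 2 * R)
    have hsub : A ∩ {w | m + 2 * R ≤ inner ℝ (v j - p) w} ⊆ N j \ N (j + 1) := by
      rintro w ⟨⟨hw1, hw2⟩, hw3⟩
      refine ⟨hw1, fun h => ?_⟩
      have h4 := h j (Nat.lt_succ_self j)
      simp only [Set.mem_ofPred_eq, inner_sub_left] at hw2 hw3
      linarith
    have h5 := measureReal_mono (μ := γ) hsub
    rw [measureReal_sdiff (hanti _ _ (Nat.le_succ j)) (hNm _), hprod] at h5
    refine le_trans ?_ h5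
    have hq0 : 0 ≤ q := measureReal_nonneg
    calc q * (γ.real (N j) - 1 / 4) ≤ q * γ.real A := by gcongr
      _ ≤ _ := by rw [mul_comm]; gcongr
  -- The events `N j` decrease, so each step loses at least the amount computed with `N k`, and the
  -- losses telescope.
  have hsum : k * (q * (γ.real (N k) - 1 / 4)) ≤ 1 := by
    have h1 : ∑ j ∈ Finset.range k, q * (γ.real (N k) - 1 / 4) ≤
        ∑ j ∈ Finset.range k, (γ.real (N j) - γ.real (N (j + 1))) := by
      refine Finset.sum_le_sum fun j hj => ?_
      have hj' := Finset.mem_range.1 hj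
      refine le_trans ?_ (hstep j hj')
      have := measureReal_mono (μ := γ) (hanti j k hj'.le)
      have hq0 : 0 ≤ q := measureReal_nonneg
      gcongr
    rw [Finset.sum_range_sub', Finset.sum_const, Finset.card_range, nsmul_eq_mul] at h1
    have h2 : γ.real (N 0) ≤ 1 := measureReal_le_one
    have h3 : 0 ≤ γ.real (N k) := measureReal_nonneg
    linarith
  have hNk : γ.real (N k) ≤ 1 / 2 := by
    by_contra! h
    nlinarith
  have hcompl : {w | ∃ i < k, m ≤ inner ℝ (v i) w} = (N k)ᶜ := by
    ext w; simp [N]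
  rw [hcompl, probReal_compl_eq_one_sub (hNm k)]
  linarith

theorem exists_card_le_of_separated (k : ℕ) (R : ℝ) {ε : ℝ} (hε : 0 < ε) :
    ∃ n : ℕ, ∀ T : Finset (EuclideanSpace ℝ (Fin k)), (∀ x ∈ T, ‖x‖ ≤ R) →
      (∀ x ∈ T, ∀ y ∈ T, x ≠ y → ε < dist x y) → T.card ≤ n := by
  have hb : TotallyBounded (Metric.closedBall (0 : EuclideanSpace ℝ (Fin k)) R) :=
    (isCompact_closedBall _ _).totallyBounded
  obtain ⟨t, ht, hcov⟩ := Metric.totallyBounded_iff.1 hb (ε / 2) (by positivity)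
  refine ⟨ht.toFinset.card, fun T hT hsep => ?_⟩
  have hex : ∀ x ∈ T, ∃ y ∈ t, dist x y < ε / 2 := by
    intro x hx
    have := hcov (mem_closedBall_zero_iff.2 (hT x hx))
    simpa using this
  choose! g hg hgd using hex
  refine Finset.card_le_card_of_injOn g (fun x hx => by simpa using hg x hx) ?_
  intro x hx y hy hxy
  by_contra hne
  have h1 := hsep x hx y hy hne
  have h2 := hgd x hx
  have h3 := hgd y hy
  rw [hxy] at h2
  linarith [dist_triangle_right x y (g y)]

omit [MeasurableSpace E] [BorelSpace E] in
-- If all points of `T` were within `ε / 4` of `K`, their projections would be `ε / 2`-separated in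
-- a ball of a `k`-dimensional space, where at most `n` such points fit.
theorem exists_le_norm_sub_starProjection {k n : ℕ} {R ε : ℝ}
    (hn : ∀ T : Finset (EuclideanSpace ℝ (Fin k)), (∀ x ∈ T, ‖x‖ ≤ R) →
      (∀ x ∈ T, ∀ y ∈ T, x ≠ y → ε / 2 < dist x y) → T.card ≤ n)
    (K : Submodule ℝ E) (hK : Module.finrank ℝ K = k) (T : Finset E) (hT : ∀ x ∈ T, ‖x‖ ≤ R)
    (hsep : ∀ x ∈ T, ∀ y ∈ T, x ≠ y → ε < dist x y) (hε : 0 < ε) (hcard : n < T.card) :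
    ∃ x ∈ T, ε / 4 ≤ ‖x - K.starProjection x‖ := by
  classical
  by_contra! h
  let e : K ≃ₗᵢ[ℝ] EuclideanSpace ℝ (Fin k) := by
    subst hK
    exact (stdOrthonormalBasis ℝ K).repr
  let g : E → EuclideanSpace ℝ (Fin k) := fun x => e (K.orthogonalProjectionOnto x)
  have hd : ∀ x y, dist (g x) (g y) = dist (K.starProjection x) (K.starProjection y) := by
    intro x y
    simp only [g, e.dist_map, Submodule.starProjection_apply]
    rfl
  have hgsep : ∀ x ∈ T, ∀ y ∈ T, x ≠ y → ε / 2 < dist (g x) (g y) := by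
    intro x hx y hy hxy
    have h1 := hsep x hx y hy hxy
    have h2 := h x hx
    have h3 := h y hy
    rw [← dist_eq_norm] at h2 h3
    rw [hd]
    have h4 := dist_triangle4 x (K.starProjection x) (K.starProjection y) y
    rw [dist_comm (K.starProjection y) y] at h4
    linarith
  have hinj : Set.InjOn g T := by
    intro x hx y hy hxy
    by_contra hne
    have := hgsep x hx y hy hne
    rw [hxy, dist_self] at this
    linarith
  have hle := hn (T.image g) ?_ ?_
  · rw [Finset.card_image_of_injOn hinj] at hle
    omega
  · intro z hz
    obtain ⟨x, hx, rfl⟩ := Finset.mem_image.1 hz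
    simp only [g, e.norm_map]
    exact (K.norm_starProjection_apply_le x).trans (hT x hx)
  · intro z hz z' hz' hne
    obtain ⟨x, hx, rfl⟩ := Finset.mem_image.1 hz
    obtain ⟨y, hy, rfl⟩ := Finset.mem_image.1 hz'
    exact hgsep x hx y hy fun h => hne (by rw [h])

end Sudakov

/-- A weak form of Sudakov's minoration: a large separated family of vectors in a ball gives rise
to a large maximum of the associated Gaussian family, uniformly in the dimension. -/
theorem exists_half_le_measureReal_of_separated {R ε m : ℝ} (hR : 0 < R) (hε : 0 < ε)
    (hm : 0 ≤ m) :
    ∃ M : ℕ, ∀ (E : Type*) [NormedAddCommGroup E] [InnerProductSpace ℝ E] [FiniteDimensional ℝ E]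
      [MeasurableSpace E] [BorelSpace E] (T : Finset E), (∀ x ∈ T, ‖x‖ ≤ R) →
      (∀ x ∈ T, ∀ y ∈ T, x ≠ y → ε < dist x y) → M ≤ T.card →
      1 / 2 ≤ (stdGaussian E).real {w | ∃ x ∈ T, m ≤ inner ℝ x w} := by
  set q := (gaussianReal 0 1).real (Set.Ici ((m + 2 * R) / (ε / 4)))
  have hq : 0 < q := by
    -- A Gaussian null set is Lebesgue null, and a half-line is not.
    refine ENNReal.toReal_pos ?_ (measure_ne_top _ _)
    intro h0
    have h1 := (gaussianReal_absolutelyContinuous' 0 one_ne_zero) h0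
    simp at h1
  obtain ⟨k, hk⟩ := exists_nat_ge (4 / q)
  rw [div_le_iff₀ hq] at hk
  choose n hn using fun k : ℕ => exists_card_le_of_separated k R (half_pos hε)
  -- The predecessors span a space of some dimension at most `k`; the sum dominates the packing
  -- bound for each of these dimensions.
  refine ⟨∑ j ∈ Finset.range (k + 1), n j + 1, ?_⟩
  intro E _ _ _ _ _ T hT hsep hcard
  classical
  have hex : ∀ j ≤ k, ∃ v : ℕ → E, ∀ i < j, v i ∈ T ∧
      ε / 4 ≤ ‖v i - (Submodule.span ℝ (v '' Set.Iio i)).starProjection (v i)‖ := by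
    intro j
    induction j with
    | zero => exact fun _ => ⟨fun _ => 0, fun i hi => absurd hi (Nat.not_lt_zero i)⟩
    | succ j ih =>
      intro hj
      obtain ⟨v, hv⟩ := ih (by omega)
      set K := Submodule.span ℝ (v '' Set.Iio j)
      have hfin : Module.finrank ℝ K ≤ j := by
        have himg : v '' Set.Iio j = ((Finset.range j).image v : Finset E) := by
          ext; simp
        have := finrank_span_finset_le_card (R := ℝ) ((Finset.range j).image v)
        rw [← himg] at this
        exact this.trans (Finset.card_image_le.trans (Finset.card_range j).le)
      have hlt : n (Module.finrank ℝ K) < T.card := by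
        have := Finset.single_le_sum (f := n) (fun _ _ => Nat.zero_le _)
          (Finset.mem_range.2 (show Module.finrank ℝ K < k + 1 by omega))
        omega
      obtain ⟨x, hx, hxK⟩ := exists_le_norm_sub_starProjection (hn _) K rfl T hT hsep hε hlt
      refine ⟨Function.update v j x, fun i hi => ?_⟩
      have himg : Function.update v j x '' Set.Iio i = v '' Set.Iio i := by
        refine Set.image_congr fun l hl => Function.update_of_ne ?_ _ _
        have : l < i := hl
        omega
      rw [himg]
      rcases Nat.lt_succ_iff_lt_or_eq.1 hi with h | rfl
      · rw [Function.update_of_ne h.ne]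
        exact hv i h
      · rw [Function.update_self]
        exact ⟨hx, hxK⟩
  obtain ⟨v, hv⟩ := hex k le_rfl
  refine (half_le_measureReal_of_sub_starProjection hR (by positivity) hm hk v
    (fun i hi => hT _ (hv i hi).1) (fun i hi => (hv i hi).2)).trans (measureReal_mono ?_)
  rintro w ⟨i, hi, hw⟩
  exact ⟨v i, (hv i hi).1, hw⟩

theorem Measurable.section_right {α β γ : Type*} [MeasurableSpace α] [MeasurableSpace β]
    [MeasurableSpace γ] {g : α × β → γ} (hg : Measurable g) (x : α) :
    Measurable fun y => g (x, y) :=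
  hg.comp measurable_prodMk_left

/-! ### The Metropolis step on the real line -/

section Metropolis

/-- The uniform law on the unit interval. -/
noncomputable def uniformUnit : Measure ℝ := volume.restrict (Set.Icc 0 1)

instance : IsProbabilityMeasure uniformUnit := ⟨by simp [uniformUnit]⟩

theorem uniformUnit_le (a : ℝ) :
    uniformUnit {u | u ≤ a} = ENNReal.ofReal (min 1 a) := by
  have h : {u : ℝ | u ≤ a} ∩ Set.Icc 0 1 = Set.Icc 0 (min 1 a) := by
    ext u
    simp only [Set.mem_inter_iff, Set.mem_ofPred_eq, Set.mem_Icc, le_min_iff]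
    tauto
  have hm : MeasurableSet {u : ℝ | u ≤ a} := measurableSet_Iic
  rw [uniformUnit, Measure.restrict_apply hm, h, Real.volume_Icc, sub_zero]

theorem uniformUnit_not_le {a : ℝ} (ha : 0 ≤ a) :
    uniformUnit {u | ¬ u ≤ a} = ENNReal.ofReal (max (1 - a) 0) := by
  have h : {u : ℝ | ¬ u ≤ a} ∩ Set.Icc 0 1 = Set.Ioc a 1 := by
    ext u
    simp only [Set.mem_inter_iff, Set.mem_ofPred_eq, Set.mem_Icc, not_le, Set.mem_Ioc]
    exact ⟨fun h => ⟨h.1, h.2.2⟩, fun h => ⟨h.1, ha.trans h.1.le, h.2⟩⟩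
  have hm : MeasurableSet {u : ℝ | ¬ u ≤ a} := (measurableSet_Iic (a := a)).compl
  rw [uniformUnit, Measure.restrict_apply hm, h, Real.volume_Ioc]
  rcases le_total (1 - a) 0 with h0 | h0
  · rw [max_eq_right h0, ENNReal.ofReal_of_nonpos h0, ENNReal.ofReal_zero]
  · rw [max_eq_left h0]

/-- One step of the Metropolis chain with stationary density `f`, started at `z.1`, with proposed
increment `s * z.2.1` and with acceptance variable `z.2.2`. -/
noncomputable def metropolisStep (f : ℝ → ℝ) (s : ℝ) (z : ℝ × ℝ × ℝ) : ℝ :=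
  if z.2.2 ≤ f (z.1 + s * z.2.1) / f z.1 then z.1 + s * z.2.1 else z.1

/-- The size of the proposed increment where the Metropolis step rejects it, and `0` elsewhere. -/
noncomputable def rejectedIncrement (f : ℝ → ℝ) (s : ℝ) (z : ℝ × ℝ × ℝ) : ℝ :=
  if z.2.2 ≤ f (z.1 + s * z.2.1) / f z.1 then 0 else |z.2.1|

variable {f : ℝ → ℝ} {s : ℝ}

theorem rejectedIncrement_nonneg (z : ℝ × ℝ × ℝ) : 0 ≤ rejectedIncrement f s z := by
  rw [rejectedIncrement]; split_ifs <;> positivity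

theorem abs_metropolisStep_sub (hs : 0 ≤ s) (z : ℝ × ℝ × ℝ) :
    |metropolisStep f s z - (z.1 + s * z.2.1)| = s * rejectedIncrement f s z := by
  rw [metropolisStep, rejectedIncrement]
  split_ifs
  · simp
  · simp [abs_mul, abs_of_nonneg hs]

theorem measurable_metropolisStep (hf : Measurable f) : Measurable (metropolisStep f s) := by
  unfold metropolisStep
  exact Measurable.ite (measurableSet_le (by fun_prop) (by fun_prop)) (by fun_prop) (by fun_prop)

theorem measurable_rejectedIncrement (hf : Measurable f) : Measurable (rejectedIncrement f s) := by
  unfold rejectedIncrement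
  refine Measurable.ite (measurableSet_le (by fun_prop) (by fun_prop)) (by fun_prop) ?_
  exact (measurable_snd.fst).abs

/-- Given the position and the proposal, rejection has probability `(1 - f (x + s * w) / f x)₊`.
This identifies the mean with the quantity of the regularity assumption for `p = 1`. -/
theorem lintegral_rejectedIncrement (hf : Measurable f) (hf0 : ∀ x, 0 ≤ f x) (P : Measure ℝ)
    [IsProbabilityMeasure P] :
    ∫⁻ z, ENNReal.ofReal (rejectedIncrement f s z) ∂(P.prod ((gaussianReal 0 1).prod uniformUnit))
      = ∫⁻ z : ℝ × ℝ, ENNReal.ofReal (|z.2| ^ (1 : ℝ) *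
        max (1 - f (z.1 + s * z.2) / f z.1) 0) ∂(P.prod (gaussianReal 0 1)) := by
  have hm : Measurable fun z => ENNReal.ofReal (rejectedIncrement f s z) :=
    (measurable_rejectedIncrement hf).ennreal_ofReal
  rw [lintegral_prod _ hm.aemeasurable, lintegral_prod _ (by fun_prop)]
  refine lintegral_congr fun x => ?_
  rw [lintegral_prod _ (hm.section_right _).aemeasurable]
  refine lintegral_congr fun w => ?_
  have ha : 0 ≤ f (x + s * w) / f x := div_nonneg (hf0 _) (hf0 _)
  have h : ∀ u, ENNReal.ofReal (rejectedIncrement f s (x, w, u)) =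
      Set.indicator {u | ¬ u ≤ f (x + s * w) / f x} (fun _ => ENNReal.ofReal |w|) u := by
    intro u
    simp only [rejectedIncrement, Set.indicator_apply, Set.mem_ofPred_eq]
    split_ifs <;> simp_all
  simp_rw [h]
  have hms : MeasurableSet {u : ℝ | ¬ u ≤ f (x + s * w) / f x} :=
    (measurableSet_Iic (a := f (x + s * w) / f x)).compl
  rw [lintegral_indicator hms, setLIntegral_const, uniformUnit_not_le ha, Real.rpow_one,
    ENNReal.ofReal_mul (abs_nonneg _)]

/-- The proposal is reversible for Lebesgue measure: replace `w` by `-w`, then translate `x` by `s *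
w`. -/
theorem lintegral_gaussianReal_swap {g : ℝ → ℝ → ℝ≥0∞} (hg : Measurable (Function.uncurry g)) :
    ∫⁻ x, ∫⁻ w, g x (x + s * w) ∂(gaussianReal 0 1) =
      ∫⁻ x, ∫⁻ w, g (x + s * w) x ∂(gaussianReal 0 1) := by
  have h1 : Measurable (Function.uncurry fun x w : ℝ => g x (x + s * w)) :=
    hg.comp (f := fun z : ℝ × ℝ => (z.1, z.1 + s * z.2)) (by fun_prop)
  have h2 : Measurable (Function.uncurry fun x w : ℝ => g (x + s * w) x) :=
    hg.comp (f := fun z : ℝ × ℝ => (z.1 + s * z.2, z.1)) (by fun_prop)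
  rw [lintegral_lintegral_swap h1.aemeasurable, lintegral_lintegral_swap h2.aemeasurable]
  have h3 : (gaussianReal 0 1).map (fun w => -w) = gaussianReal 0 1 := by
    rw [gaussianReal_map_neg, neg_zero]
  have h4 : Measurable fun w : ℝ => ∫⁻ x, g (x + s * w) x :=
    (h2.comp measurable_swap).lintegral_prod_right'
  conv_rhs => rw [← h3, lintegral_map h4 measurable_neg]
  refine lintegral_congr fun w => ?_
  rw [← lintegral_add_right_eq_self (fun x => g (x + s * -w) x) (s * w)]
  refine lintegral_congr fun x => ?_
  congr 1
  ring

/-- Detailed balance: the density `f x * min 1 (f y / f x) = min (f x) (f y)` of accepted moves is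
symmetric, and so is the proposal, while rejected mass stays in place. -/
theorem measurePreserving_metropolisStep (hf : Measurable f) (hf0 : ∀ x, 0 ≤ f x) (P : Measure ℝ)
    [IsProbabilityMeasure P] (hP : P = volume.withDensity fun x => ENNReal.ofReal (f x)) :
    MeasurePreserving (metropolisStep f s) (P.prod ((gaussianReal 0 1).prod uniformUnit)) P := by
  refine ⟨measurable_metropolisStep hf, Measure.ext fun A hA => ?_⟩
  have hT : Measurable (metropolisStep f s) := measurable_metropolisStep hf
  rw [Measure.map_apply hT hA, ← lintegral_indicator_one (hT hA), ← lintegral_indicator_one hA]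
  have hm1 : Measurable (A.indicator (1 : ℝ → ℝ≥0∞)) := measurable_one.indicator hA
  have hm2 : Measurable ((metropolisStep f s ⁻¹' A).indicator (1 : ℝ × ℝ × ℝ → ℝ≥0∞)) :=
    measurable_one.indicator (hT hA)
  rw [lintegral_prod _ hm2.aemeasurable]
  let a : ℝ → ℝ → ℝ≥0∞ := fun x y => ENNReal.ofReal (min 1 (f y / f x))
  let b : ℝ → ℝ → ℝ≥0∞ := fun x y => ENNReal.ofReal (max (1 - f y / f x) 0)
  have hab : ∀ x y, a x y + b x y = 1 := by
    intro x y
    have h0 : 0 ≤ f y / f x := div_nonneg (hf0 _) (hf0 _)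
    rw [← ENNReal.ofReal_add (le_min zero_le_one h0) (le_max_right _ _), ← ENNReal.ofReal_one]
    congr 1
    rcases le_total 1 (f y / f x) with h | h
    · rw [min_eq_left h, max_eq_right (by linarith), add_zero]
    · rw [min_eq_right h, max_eq_left (by linarith)]; ring
  have hfa : ∀ x y, ENNReal.ofReal (f x) * a x y = ENNReal.ofReal (min (f x) (f y)) := by
    intro x y
    rw [← ENNReal.ofReal_mul (hf0 x)]
    congr 1
    -- At a zero of `f` the quotient is `0` by convention, but the weight vanishes as well.
    rcases (hf0 x).eq_or_lt with h | h
    · rw [← h, zero_mul, min_eq_left (hf0 y)]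
    · rw [mul_min_of_nonneg _ _ h.le, mul_one, mul_div_cancel₀ _ h.ne']
  have hinner : ∀ x w, ∫⁻ u, (metropolisStep f s ⁻¹' A).indicator 1 (x, w, u) ∂uniformUnit =
      a x (x + s * w) * A.indicator 1 (x + s * w) + b x (x + s * w) * A.indicator 1 x := by
    intro x w
    have h0 : 0 ≤ f (x + s * w) / f x := div_nonneg (hf0 _) (hf0 _)
    have h : ∀ u, (metropolisStep f s ⁻¹' A).indicator (1 : ℝ × ℝ × ℝ → ℝ≥0∞) (x, w, u) =
        Set.indicator {u | u ≤ f (x + s * w) / f x} (fun _ => A.indicator 1 (x + s * w)) u +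
        Set.indicator {u | ¬ u ≤ f (x + s * w) / f x} (fun _ => A.indicator 1 x) u := by
      intro u
      have hT' : (metropolisStep f s ⁻¹' A).indicator (1 : ℝ × ℝ × ℝ → ℝ≥0∞) (x, w, u) =
          A.indicator 1 (metropolisStep f s (x, w, u)) := rfl
      rw [hT', metropolisStep]
      by_cases hu : u ≤ f (x + s * w) / f x
      · rw [if_pos hu, Set.indicator_of_mem (s := {u | u ≤ _}) hu,
          Set.indicator_of_notMem (s := {u | ¬ u ≤ _}) (not_not.2 hu), add_zero]
      · rw [if_neg hu, Set.indicator_of_mem (s := {u | ¬ u ≤ _}) hu,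
          Set.indicator_of_notMem (s := {u | u ≤ _}) hu, zero_add]
    have hms : MeasurableSet {u : ℝ | ¬ u ≤ f (x + s * w) / f x} :=
      (measurableSet_Iic (a := f (x + s * w) / f x)).compl
    have hms' : MeasurableSet {u : ℝ | u ≤ f (x + s * w) / f x} := measurableSet_Iic
    simp_rw [h]
    rw [lintegral_add_left (measurable_const.indicator hms'), lintegral_indicator hms',
      lintegral_indicator hms, setLIntegral_const, setLIntegral_const, uniformUnit_le _,
      uniformUnit_not_le h0, mul_comm, mul_comm (A.indicator 1 x)]
  have hinner2 : ∀ x, ∫⁻ y, (metropolisStep f s ⁻¹' A).indicator 1 (x, y)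
      ∂((gaussianReal 0 1).prod uniformUnit) = ∫⁻ w, (a x (x + s * w) * A.indicator 1 (x + s * w) +
        b x (x + s * w) * A.indicator 1 x) ∂(gaussianReal 0 1) := by
    intro x
    rw [lintegral_prod _ (hm2.section_right _).aemeasurable]
    exact lintegral_congr fun w => hinner x w
  simp_rw [hinner2]
  have hma : Measurable (Function.uncurry a) := by
    simp only [a, Function.uncurry_def]; fun_prop
  have hmb : Measurable (Function.uncurry b) := by
    simp only [b, Function.uncurry_def]; fun_prop
  have hma' : Measurable fun z : ℝ × ℝ => a z.1 (z.1 + s * z.2) :=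
    hma.comp (f := fun z : ℝ × ℝ => (z.1, z.1 + s * z.2)) (by fun_prop)
  have hmb' : Measurable fun z : ℝ × ℝ => b z.1 (z.1 + s * z.2) :=
    hmb.comp (f := fun z : ℝ × ℝ => (z.1, z.1 + s * z.2)) (by fun_prop)
  have hmA : Measurable fun z : ℝ × ℝ => A.indicator (1 : ℝ → ℝ≥0∞) (z.1 + s * z.2) :=
    hm1.comp (f := fun z : ℝ × ℝ => z.1 + s * z.2) (by fun_prop)
  have hmf : Measurable fun x => ENNReal.ofReal (f x) := hf.ennreal_ofReal
  have hmG : Measurable fun z : ℝ × ℝ => a z.1 (z.1 + s * z.2) * A.indicator 1 (z.1 + s * z.2) +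
        b z.1 (z.1 + s * z.2) * A.indicator 1 z.1 :=
    (hma'.mul hmA).add (hmb'.mul (hm1.comp measurable_fst))
  rw [hP, lintegral_withDensity_eq_lintegral_mul _ hmf hmG.lintegral_prod_right',
    lintegral_withDensity_eq_lintegral_mul _ hmf hm1]
  have hsplit : ∀ x, ENNReal.ofReal (f x) * ∫⁻ w, (a x (x + s * w) * A.indicator 1 (x + s * w) +
        b x (x + s * w) * A.indicator 1 x) ∂(gaussianReal 0 1) =
      ∫⁻ w, ENNReal.ofReal (min (f x) (f (x + s * w))) * A.indicator 1 (x + s * w)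
        ∂(gaussianReal 0 1) +
      ∫⁻ w, ENNReal.ofReal (f x) * b x (x + s * w) * A.indicator 1 x ∂(gaussianReal 0 1) := by
    intro x
    rw [← lintegral_const_mul _ (hmG.section_right _), ← lintegral_add_left]
    · refine lintegral_congr fun w => ?_
      rw [mul_add, ← mul_assoc, hfa, mul_assoc]
    · refine Measurable.mul ?_ (hmA.section_right _)
      fun_prop
  simp only [Pi.mul_apply, hsplit]
  have hmg : Measurable (Function.uncurry fun x y : ℝ =>
      ENNReal.ofReal (min (f x) (f y)) * A.indicator (1 : ℝ → ℝ≥0∞) y) := by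
    simp only [Function.uncurry_def]
    exact Measurable.mul (by fun_prop) (hm1.comp measurable_snd)
  have hmg1 : Measurable fun z : ℝ × ℝ =>
      ENNReal.ofReal (min (f z.1) (f (z.1 + s * z.2))) * A.indicator (1 : ℝ → ℝ≥0∞) z.1 :=
    Measurable.mul (by fun_prop) (hm1.comp measurable_fst)
  have hmg2 : Measurable fun z : ℝ × ℝ => ENNReal.ofReal (min (f z.1) (f (z.1 + s * z.2))) *
      A.indicator (1 : ℝ → ℝ≥0∞) (z.1 + s * z.2) :=
    Measurable.mul (by fun_prop) hmA
  -- The accepted mass arriving in `A` becomes the accepted mass starting in `A`, which combines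
  -- with the mass rejected there to the full mass.
  rw [lintegral_add_left hmg2.lintegral_prod_right', lintegral_gaussianReal_swap hmg]
  simp_rw [min_comm (f (_ + _))]
  rw [← lintegral_add_left hmg1.lintegral_prod_right']
  refine lintegral_congr fun x => ?_
  rw [← lintegral_add_left (hmg1.section_right _)]
  have h5 : ∀ w, ENNReal.ofReal (min (f x) (f (x + s * w))) * A.indicator (1 : ℝ → ℝ≥0∞) x +
      ENNReal.ofReal (f x) * b x (x + s * w) * A.indicator 1 x =
      ENNReal.ofReal (f x) * A.indicator 1 x := by
    intro w
    rw [← hfa, ← add_mul, ← mul_add, hab, mul_one]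
  simp_rw [h5]
  simp

end Metropolis

/-! ### Linear energies, near-minimal states and the minimal energy -/

section NearMinimizers

variable {I S : Type*} [Fintype I]

/-- The energy with disorder `x` of a state with feature vector `φ σ`. -/
def linearEnergy (φ : S → I → ℝ) (x : I → ℝ) (σ : S) : ℝ := -∑ b, x b * φ σ b

theorem measurable_linearEnergy (φ : S → I → ℝ) (σ : S) :
    Measurable fun x => linearEnergy φ x σ := by
  unfold linearEnergy
  fun_prop

theorem abs_linearEnergy_le {φ : S → I → ℝ} (hφ : ∀ σ b, |φ σ b| ≤ 1) (x : I → ℝ) (σ : S) :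
    |linearEnergy φ x σ| ≤ ∑ b, |x b| := by
  rw [linearEnergy, abs_neg]
  refine (Finset.abs_sum_le_sum_abs _ _).trans (Finset.sum_le_sum fun b _ => ?_)
  rw [abs_mul]
  exact mul_le_of_le_one_right (abs_nonneg _) (hφ σ b)

/-- The states `τ` of `T` are separated, and their energies are within `K` of the minimum. -/
def IsSeparatedNearMinimal (φ : S → I → ℝ) (s ε K : ℝ) (x : I → ℝ) (T : Finset S) : Prop :=
  (∀ σ ∈ T, ∀ τ ∈ T, σ ≠ τ → ε < dist (WithLp.toLp 2 (s • φ σ)) (WithLp.toLp 2 (s • φ τ))) ∧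
    ∀ σ ∈ T, ∀ τ, linearEnergy φ x σ ≤ linearEnergy φ x τ + K

theorem measurableSet_isSeparatedNearMinimal [Finite S] (φ : S → I → ℝ) (s ε K : ℝ) (M : ℕ) :
    MeasurableSet {x | ∃ T : Finset S, M ≤ T.card ∧ IsSeparatedNearMinimal φ s ε K x T} := by
  refine measurableSet_setOfPred.2 (Measurable.exists fun T => measurable_const.and
    (measurable_const.and (Measurable.forall fun σ => Measurable.forall fun _ =>
      Measurable.forall fun τ => measurableSet_setOfPred.1 ?_)))
  exact measurableSet_le (measurable_linearEnergy φ σ)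
    ((measurable_linearEnergy φ τ).add measurable_const)

variable [Fintype S] [Nonempty S]

/-- The minimal energy. -/
noncomputable def minEnergy (φ : S → I → ℝ) (x : I → ℝ) : ℝ :=
  Finset.univ.inf' Finset.univ_nonempty (linearEnergy φ x)

theorem minEnergy_le (φ : S → I → ℝ) (x : I → ℝ) (σ : S) :
    minEnergy φ x ≤ linearEnergy φ x σ :=
  Finset.inf'_le _ (Finset.mem_univ σ)

theorem exists_linearEnergy_eq_minEnergy (φ : S → I → ℝ) (x : I → ℝ) :
    ∃ σ, linearEnergy φ x σ = minEnergy φ x := by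
  obtain ⟨σ, -, h⟩ := Finset.exists_mem_eq_inf' Finset.univ_nonempty (linearEnergy φ x)
  exact ⟨σ, h.symm⟩

theorem measurable_minEnergy (φ : S → I → ℝ) : Measurable (minEnergy φ) := by
  have h : minEnergy φ = Finset.univ.inf' Finset.univ_nonempty
      (fun σ x => linearEnergy φ x σ) := by
    ext x
    simp [minEnergy, Finset.inf'_apply]
  rw [h]
  exact Finset.inf'_induction Finset.univ_nonempty _ (fun _ h1 _ h2 => h1.inf h2)
    fun σ _ => measurable_linearEnergy φ σ

theorem integrable_minEnergy {φ : S → I → ℝ} (hφ : ∀ σ b, |φ σ b| ≤ 1) {P : Measure ℝ}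
    [IsProbabilityMeasure P] (hint : Integrable (fun x : ℝ => x) P) :
    Integrable (minEnergy φ) (Measure.pi fun _ : I => P) := by
  have h : Integrable (fun x : I → ℝ => ∑ b, |x b|) (Measure.pi fun _ : I => P) :=
    integrable_finsetSum _ fun b _ =>
      (integrable_comp_eval (μ := fun _ : I => P) (i := b) (f := fun x : ℝ => x) hint).abs
  refine h.mono' (measurable_minEnergy φ).aestronglyMeasurable (ae_of_all _ fun x => ?_)
  obtain ⟨σ, hσ⟩ := exists_linearEnergy_eq_minEnergy φ x
  rw [← hσ]
  exact abs_linearEnergy_le hφ x σ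

theorem measurePreserving_toLp_fst :
    MeasurePreserving (fun y : I → ℝ × ℝ => WithLp.toLp 2 fun b => (y b).1)
      (Measure.pi fun _ => (gaussianReal 0 1).prod uniformUnit)
      (stdGaussian (EuclideanSpace ℝ I)) := by
  have h1 : MeasurePreserving (fun (y : I → ℝ × ℝ) b => (y b).1)
      (Measure.pi fun _ => (gaussianReal 0 1).prod uniformUnit)
      (Measure.pi fun _ => gaussianReal 0 1) :=
    measurePreserving_pi _ _ fun _ => measurePreserving_fst
  have h2 : MeasurePreserving (WithLp.toLp 2 : (I → ℝ) → EuclideanSpace ℝ I)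
      (Measure.pi fun _ => gaussianReal 0 1) (stdGaussian (EuclideanSpace ℝ I)) :=
    ⟨by fun_prop, map_pi_eq_stdGaussian⟩
  exact h2.comp h1

theorem lintegral_pi_prod (P : Measure ℝ) [IsProbabilityMeasure P] {g : (I → ℝ × ℝ × ℝ) → ℝ≥0∞}
    (hg : Measurable g) :
    ∫⁻ z, g z ∂(Measure.pi fun _ => P.prod ((gaussianReal 0 1).prod uniformUnit)) =
      ∫⁻ x, ∫⁻ y, g (fun b => (x b, y b))
        ∂(Measure.pi fun _ => (gaussianReal 0 1).prod uniformUnit) ∂(Measure.pi fun _ => P) := by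
  have h := measurePreserving_arrowProdEquivProdArrow ℝ (ℝ × ℝ) I (fun _ => P)
    (fun _ => (gaussianReal 0 1).prod uniformUnit)
  have hm : Measurable fun p : (I → ℝ) × (I → ℝ × ℝ) => g fun b => (p.1 b, p.2 b) :=
    hg.comp (by fun_prop)
  rw [← lintegral_prod _ hm.aemeasurable, ← h.lintegral_comp hm]
  rfl

/-! ### One Metropolis step in every coordinate -/

section Resampling

variable (φ : S → I → ℝ) (f : ℝ → ℝ) (s : ℝ)

/-- The change of the minimal energy in one Metropolis step. -/
noncomputable def energyChange (z : I → ℝ × ℝ × ℝ) : ℝ :=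
  minEnergy φ (fun b => metropolisStep f s (z b)) - minEnergy φ (fun b => (z b).1)

/-- The total size of the increments that are rejected in one Metropolis step. -/
noncomputable def totalRejected (z : I → ℝ × ℝ × ℝ) : ℝ := ∑ b, s * rejectedIncrement f s (z b)

variable {φ f s}

/-- Any state `σ` is a competitor for the new minimum. The new disorder differs from `x + s * w`
only by the rejected increments, and these count at most fully because `|φ σ b| ≤ 1`. -/
theorem energyChange_sub_le (hφ : ∀ σ b, |φ σ b| ≤ 1) (hs : 0 ≤ s) (z : I → ℝ × ℝ × ℝ) (σ : S) :
    energyChange φ f s z - totalRejected f s z ≤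
      linearEnergy φ (fun b => (z b).1) σ - minEnergy φ (fun b => (z b).1) -
        inner ℝ (WithLp.toLp 2 (s • φ σ)) (WithLp.toLp 2 fun b => (z b).2.1) := by
  have h1 := minEnergy_le φ (fun b => metropolisStep f s (z b)) σ
  have h2 : linearEnergy φ (fun b => metropolisStep f s (z b)) σ ≤
      linearEnergy φ (fun b => (z b).1) σ -
        inner ℝ (WithLp.toLp 2 (s • φ σ)) (WithLp.toLp 2 fun b => (z b).2.1) +
        totalRejected f s z := by
    simp only [linearEnergy, totalRejected, EuclideanSpace.inner_toLp_toLp, dotProduct,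
      Pi.smul_apply, smul_eq_mul, star_trivial]
    rw [neg_sub_left, neg_add_eq_sub, neg_le_iff_add_nonneg, ← Finset.sum_add_distrib,
      ← Finset.sum_sub_distrib, ← Finset.sum_add_distrib]
    refine Finset.sum_nonneg fun b _ => ?_
    have h3 := abs_metropolisStep_sub (f := f) hs (z b)
    have h4 := abs_mul (metropolisStep f s (z b) - ((z b).1 + s * (z b).2.1)) (φ σ b)
    have h5 := mul_le_of_le_one_right
      (abs_nonneg (metropolisStep f s (z b) - ((z b).1 + s * (z b).2.1))) (hφ σ b)
    have h6 := neg_abs_le ((metropolisStep f s (z b) - ((z b).1 + s * (z b).2.1)) * φ σ b)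
    nlinarith
  rw [energyChange]
  linarith

theorem measurable_totalRejected (hf : Measurable f) :
    Measurable (totalRejected f s : (I → ℝ × ℝ × ℝ) → ℝ) := by
  unfold totalRejected
  exact Finset.measurable_sum _ fun b _ =>
    ((measurable_rejectedIncrement hf).comp (measurable_pi_apply b)).const_mul s

theorem measurable_energyChange (hf : Measurable f) : Measurable (energyChange φ f s) := by
  unfold energyChange
  refine ((measurable_minEnergy φ).comp ?_).sub ((measurable_minEnergy φ).comp (by fun_prop))
  exact measurable_pi_lambda _ fun b => (measurable_metropolisStep hf).comp (measurable_pi_apply b)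

/-- Each coordinate contributes at most `s * (C * s)`: one factor `s` is the size of the increment,
the other comes from the rejection bound. -/
theorem lintegral_totalRejected_le (hf : Measurable f) (hf0 : ∀ x, 0 ≤ f x) (P : Measure ℝ)
    [IsProbabilityMeasure P] (hs : 0 ≤ s) {C B : ℝ} (hC0 : 0 ≤ C)
    (hC : ∫⁻ z : ℝ × ℝ, ENNReal.ofReal (|z.2| ^ (1 : ℝ) *
      max (1 - f (z.1 + s * z.2) / f z.1) 0) ∂(P.prod (gaussianReal 0 1)) ≤ ENNReal.ofReal (C * s))
    (hB : Fintype.card I * s ^ 2 ≤ B) :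
    ∫⁻ z, ENNReal.ofReal (totalRejected f s z)
      ∂(Measure.pi fun _ : I => P.prod ((gaussianReal 0 1).prod uniformUnit)) ≤
      ENNReal.ofReal (B * C) := by
  have hmr : Measurable fun z => ENNReal.ofReal (s * rejectedIncrement f s z) :=
    ((measurable_rejectedIncrement hf).const_mul s).ennreal_ofReal
  have h1 : ∀ z : I → ℝ × ℝ × ℝ, ENNReal.ofReal (totalRejected f s z) =
      ∑ b, ENNReal.ofReal (s * rejectedIncrement f s (z b)) := fun z =>
    ENNReal.ofReal_sum_of_nonneg fun b _ => mul_nonneg hs (rejectedIncrement_nonneg _)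
  simp_rw [h1]
  have hmb : ∀ b : I, Measurable fun z : I → ℝ × ℝ × ℝ =>
      ENNReal.ofReal (s * rejectedIncrement f s (z b)) := fun b =>
    hmr.comp (measurable_pi_apply b)
  rw [lintegral_finsetSum _ fun b _ => hmb b]
  have h2 : ∀ b : I, ∫⁻ z, ENNReal.ofReal (s * rejectedIncrement f s (z b))
      ∂(Measure.pi fun _ : I => P.prod ((gaussianReal 0 1).prod uniformUnit)) ≤
      ENNReal.ofReal (s * (C * s)) := by
    intro b
    rw [(measurePreserving_eval (fun _ : I => P.prod ((gaussianReal 0 1).prod uniformUnit))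
      b).lintegral_comp hmr]
    simp_rw [ENNReal.ofReal_mul hs]
    rw [lintegral_const_mul _ (measurable_rejectedIncrement hf).ennreal_ofReal,
      lintegral_rejectedIncrement hf hf0]
    gcongr
  refine (Finset.sum_le_sum fun b _ => h2 b).trans ?_
  rw [Finset.sum_const, Finset.card_univ, nsmul_eq_mul, ← ENNReal.ofReal_natCast,
    ← ENNReal.ofReal_mul (by positivity)]
  refine ENNReal.ofReal_le_ofReal ?_
  calc (Fintype.card I : ℝ) * (s * (C * s)) = Fintype.card I * s ^ 2 * C := by ring
    _ ≤ B * C := by gcongr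

/-- Stationarity: the old and the new disorder have the same law and the minimal energy is
integrable, so its change has mean zero. -/
theorem lintegral_neg_energyChange (hf : Measurable f) (hf0 : ∀ x, 0 ≤ f x) (P : Measure ℝ)
    [IsProbabilityMeasure P] (hP : P = volume.withDensity fun x => ENNReal.ofReal (f x))
    (hint : Integrable (fun x : ℝ => x) P) (hφ : ∀ σ b, |φ σ b| ≤ 1) :
    ∫⁻ z, ENNReal.ofReal (-energyChange φ f s z)
      ∂(Measure.pi fun _ : I => P.prod ((gaussianReal 0 1).prod uniformUnit)) =
    ∫⁻ z, ENNReal.ofReal (energyChange φ f s z)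
      ∂(Measure.pi fun _ : I => P.prod ((gaussianReal 0 1).prod uniformUnit)) := by
  set Q := Measure.pi fun _ : I => P.prod ((gaussianReal 0 1).prod uniformUnit)
  have hT : MeasurePreserving (fun (z : I → ℝ × ℝ × ℝ) b => metropolisStep f s (z b)) Q
      (Measure.pi fun _ => P) :=
    measurePreserving_pi _ _ fun _ => measurePreserving_metropolisStep hf hf0 P hP
  have hX : MeasurePreserving (fun (z : I → ℝ × ℝ × ℝ) b => (z b).1) Q
      (Measure.pi fun _ => P) :=
    measurePreserving_pi _ _ fun _ => measurePreserving_fst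
  have hV := integrable_minEnergy hφ hint
  have hVm := (measurable_minEnergy φ).aestronglyMeasurable (μ := Measure.pi fun _ : I => P)
  have h1 := hT.integrable_comp_of_integrable hV
  have h2 := hX.integrable_comp_of_integrable hV
  have hD : Integrable (energyChange φ f s) Q := h1.sub h2
  have h0 : ∫ z, energyChange φ f s z ∂Q = 0 := by
    have e1 : ∫ z, minEnergy φ (fun b => metropolisStep f s (z b)) ∂Q =
        ∫ x, minEnergy φ x ∂(Measure.pi fun _ => P) := by
      rw [← hT.map_eq] at hVm ⊢
      exact (integral_map hT.aemeasurable hVm).symm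
    have e2 : ∫ z, minEnergy φ (fun b => (z b).1) ∂Q =
        ∫ x, minEnergy φ x ∂(Measure.pi fun _ => P) := by
      rw [← hX.map_eq] at hVm ⊢
      exact (integral_map hX.aemeasurable hVm).symm
    have e3 : ∫ z, energyChange φ f s z ∂Q = ∫ z, minEnergy φ (fun b => metropolisStep f s (z b)) ∂Q
      - ∫ z, minEnergy φ (fun b => (z b).1) ∂Q := integral_sub h1 h2
    rw [e3, e1, e2, sub_self]
  rw [integral_eq_lintegral_pos_part_sub_lintegral_neg_part hD, sub_eq_zero] at h0
  refine ((ENNReal.toReal_eq_toReal_iff' ?_ ?_).1 h0).symm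
  · exact (hD.lintegral_lt_top).ne
  · exact (hD.neg.lintegral_lt_top).ne

omit [Fintype S] [Nonempty S] in
theorem norm_toLp_smul_le (hφ : ∀ σ b, |φ σ b| ≤ 1) {B : ℝ} (hB : Fintype.card I * s ^ 2 ≤ B)
    (σ : S) : ‖(WithLp.toLp 2 (s • φ σ) : EuclideanSpace ℝ I)‖ ≤ √B := by
  rw [EuclideanSpace.norm_eq]
  refine Real.sqrt_le_sqrt (le_trans ?_ hB)
  simp only [Pi.smul_apply, smul_eq_mul, norm_mul, mul_pow, Real.norm_eq_abs, sq_abs]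
  calc ∑ b, s ^ 2 * φ σ b ^ 2 ≤ ∑ _b : I, s ^ 2 := by
        refine Finset.sum_le_sum fun b _ => mul_le_of_le_one_right (sq_nonneg s) ?_
        exact (sq_le_one_iff_abs_le_one _).2 (hφ σ b)
    _ = Fintype.card I * s ^ 2 := by simp

/-- The minimizer for the old disorder is the competitor. It does not depend on the proposals, so
only one centred Gaussian of standard deviation at most `√B` is left. -/
theorem lintegral_energyChange_sub_le (hf : Measurable f) (P : Measure ℝ) [IsProbabilityMeasure P]
    (hφ : ∀ σ b, |φ σ b| ≤ 1) (hs : 0 ≤ s) {B : ℝ} (hB : Fintype.card I * s ^ 2 ≤ B) :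
    ∫⁻ z, ENNReal.ofReal (energyChange φ f s z - totalRejected f s z)
      ∂(Measure.pi fun _ : I => P.prod ((gaussianReal 0 1).prod uniformUnit)) ≤
      ENNReal.ofReal √B := by
  have hmz : Measurable fun z : I → ℝ × ℝ × ℝ =>
      ENNReal.ofReal (energyChange φ f s z - totalRejected f s z) :=
    ((measurable_energyChange hf).sub (measurable_totalRejected hf)).ennreal_ofReal
  rw [lintegral_pi_prod P hmz]
  refine (lintegral_mono (g := fun _ => ENNReal.ofReal √B) fun x => ?_).trans (by simp)
  obtain ⟨σ, hσ⟩ := exists_linearEnergy_eq_minEnergy φ x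
  set v : EuclideanSpace ℝ I := WithLp.toLp 2 (s • φ σ)
  have hm : Measurable fun w : EuclideanSpace ℝ I => ENNReal.ofReal |inner ℝ v w| :=
    (measurable_inner_left v).abs.ennreal_ofReal
  have h1 := (integral_abs_inner_stdGaussian_le v).trans
    (ENNReal.ofReal_le_ofReal (norm_toLp_smul_le hφ hB σ))
  rw [← measurePreserving_toLp_fst.lintegral_comp hm] at h1
  refine (lintegral_mono fun y => ENNReal.ofReal_le_ofReal ?_).trans h1
  have h2 := energyChange_sub_le (f := f) hφ hs (fun b => (x b, y b)) σ
  simp only [hσ, sub_self, zero_sub] at h2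
  exact h2.trans (neg_le_abs _)

/-- For `x ∈ G`, with probability at least `1 / 2` over the proposals, some state starting within
`K` of the minimum gains `m`, and it forces the minimal energy down by `m - K`, up to rejections. -/
theorem measure_mul_le_lintegral_sub_energyChange (hf : Measurable f) (P : Measure ℝ)
    [IsProbabilityMeasure P] (hφ : ∀ σ b, |φ σ b| ≤ 1) (hs : 0 ≤ s) {K m : ℝ} {G : Set (I → ℝ)}
    (hG : MeasurableSet G)
    (hGT : ∀ x ∈ G, ∃ T : Finset S, (∀ σ ∈ T, ∀ τ, linearEnergy φ x σ ≤ linearEnergy φ x τ + K) ∧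
      1 / 2 ≤ (stdGaussian (EuclideanSpace ℝ I)).real
        {w | ∃ σ ∈ T, m ≤ inner ℝ (WithLp.toLp 2 (s • φ σ)) w}) :
    ENNReal.ofReal ((m - K) / 2) * (Measure.pi fun _ => P) G ≤
    ∫⁻ z, ENNReal.ofReal (totalRejected f s z - energyChange φ f s z)
      ∂(Measure.pi fun _ : I => P.prod ((gaussianReal 0 1).prod uniformUnit)) := by
  have hmz : Measurable fun z : I → ℝ × ℝ × ℝ =>
      ENNReal.ofReal (totalRejected f s z - energyChange φ f s z) :=
    ((measurable_totalRejected hf).sub (measurable_energyChange hf)).ennreal_ofReal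
  rw [lintegral_pi_prod P hmz, ← lintegral_indicator_const hG]
  refine lintegral_mono (Set.indicator_le fun x hx => ?_)
  obtain ⟨T, hT, hhalf⟩ := hGT x hx
  set A : Set (EuclideanSpace ℝ I) := {w | ∃ σ ∈ T, m ≤ inner ℝ (WithLp.toLp 2 (s • φ σ)) w}
  have hA : MeasurableSet A := by
    refine measurableSet_setOfPred.2 (Measurable.exists fun σ => measurable_const.and
      (measurableSet_setOfPred.1 ?_))
    exact measurableSet_le measurable_const (measurable_inner_left _)
  have h1 : ENNReal.ofReal ((m - K) / 2) ≤
      ENNReal.ofReal (m - K) * stdGaussian (EuclideanSpace ℝ I) A := by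
    rw [div_eq_mul_one_div, mul_comm, ENNReal.ofReal_mul (by norm_num), mul_comm]
    gcongr
    exact (ENNReal.ofReal_le_iff_le_toReal (measure_ne_top _ _)).2 hhalf
  refine h1.trans ?_
  rw [← lintegral_indicator_const hA,
    ← measurePreserving_toLp_fst.lintegral_comp (measurable_const.indicator hA)]
  refine lintegral_mono fun y => ?_
  by_cases hy : (WithLp.toLp 2 fun b => (y b).1 : EuclideanSpace ℝ I) ∈ A
  · rw [Set.indicator_of_mem hy]
    obtain ⟨σ, hσ, hm⟩ := hy
    obtain ⟨τ, hτ⟩ := exists_linearEnergy_eq_minEnergy φ x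
    have h2 := energyChange_sub_le (f := f) hφ hs (fun b => (x b, y b)) σ
    have h3 := hT σ hσ τ
    refine ENNReal.ofReal_le_ofReal ?_
    simp only at h2
    linarith
  · rw [Set.indicator_of_notMem hy]
    exact zero_le

end Resampling

end NearMinimizers

/-- For disorder with a regular density, it is unlikely that there are many separated states whose
energy is within `K` of the minimum, uniformly in the size of the system. -/
theorem exists_measure_isSeparatedNearMinimal_le {P : Measure ℝ} [IsProbabilityMeasure P]
    (hP : RandomMinimization.HasRegularDensity P) (hint : Integrable (fun x : ℝ => x) P)
    {B ε K η : ℝ} (hB : 0 < B) (hε : 0 < ε) (hK : 0 ≤ K) (hη : 0 < η) :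
    ∃ M : ℕ, ∀ (I S : Type) [Fintype I] [Finite S] [Nonempty S] (φ : S → I → ℝ) (s : ℝ),
      (∀ σ b, |φ σ b| ≤ 1) → 0 ≤ s → Fintype.card I * s ^ 2 ≤ B →
      (Measure.pi fun _ : I => P)
        {x | ∃ T : Finset S, M ≤ T.card ∧ IsSeparatedNearMinimal φ s ε K x T} ≤
        ENNReal.ofReal η := by
  obtain ⟨f, hf, hf0, hPf, hreg⟩ := hP
  obtain ⟨C, hC0, hC⟩ := hreg 1 zero_le_one
  have hR : 0 < √B := Real.sqrt_pos.2 hB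
  -- The first `B * C` bounds the mean rejection, and `√B + B * C` the mean positive part of the
  -- energy change. The level `m = K + 2 * (a / η)` below makes `(m - K) / 2` equal to `a / η`.
  set a := B * C + (√B + B * C)
  have ha : 0 < a := by positivity
  obtain ⟨M, hM⟩ := exists_half_le_measureReal_of_separated (m := K + 2 * (a / η)) hR hε
    (by positivity)
  refine ⟨M, fun I S _ _ _ φ s hφ hs hIB => ?_⟩
  have := Fintype.ofFinite S
  classical
  set Q := Measure.pi fun _ : I => P.prod ((gaussianReal 0 1).prod uniformUnit)
  set G := {x | ∃ T : Finset S, M ≤ T.card ∧ IsSeparatedNearMinimal φ s ε K x T}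
  have hG : MeasurableSet G := measurableSet_isSeparatedNearMinimal φ s ε K M
  have hlow := measure_mul_le_lintegral_sub_energyChange (φ := φ) (f := f) (s := s)
    (m := K + 2 * (a / η)) (K := K) hf P hφ hs hG ?_
  · have hr := lintegral_totalRejected_le (I := I) hf hf0 P hs hC0.le (hC s hs) hIB
    have hup : ∫⁻ z, ENNReal.ofReal (totalRejected f s z - energyChange φ f s z) ∂Q ≤
        ENNReal.ofReal a := by
      have hrm : Measurable fun z : I → ℝ × ℝ × ℝ => ENNReal.ofReal (totalRejected f s z) :=
        (measurable_totalRejected hf).ennreal_ofReal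
      have h1 : ∫⁻ z, ENNReal.ofReal (energyChange φ f s z) ∂Q ≤
          ENNReal.ofReal √B + ENNReal.ofReal (B * C) := by
        refine le_trans ?_ (add_le_add (lintegral_energyChange_sub_le hf P hφ hs hIB) hr)
        rw [← lintegral_add_right _ hrm]
        refine lintegral_mono fun z => le_trans (le_of_eq ?_) ENNReal.ofReal_add_le
        rw [sub_add_cancel]
      rw [ENNReal.ofReal_add (by positivity) (by positivity),
        ENNReal.ofReal_add (by positivity) (by positivity)]
      refine le_trans ?_ (add_le_add hr h1)
      -- The upper bound on increases of the minimal energy becomes a bound on its decreases.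
      rw [← lintegral_neg_energyChange hf hf0 P hPf hint hφ, ← lintegral_add_left hrm]
      exact lintegral_mono fun z => by
        rw [sub_eq_add_neg]
        exact ENNReal.ofReal_add_le
    have h2 := hlow.trans hup
    rw [show (K + 2 * (a / η) - K) / 2 = a / η by ring] at h2
    have h3 : ENNReal.ofReal a = ENNReal.ofReal (a / η) * ENNReal.ofReal η := by
      rw [← ENNReal.ofReal_mul (by positivity), div_mul_cancel₀ _ hη.ne']
    rw [h3] at h2
    exact (ENNReal.mul_le_mul_iff_right (ENNReal.ofReal_pos.2 (by positivity)).ne'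
      ENNReal.ofReal_ne_top).1 h2
  · rintro x ⟨T, hTM, hsep, hmin⟩
    refine ⟨T, hmin, ?_⟩
    let v : S → EuclideanSpace ℝ I := fun σ => WithLp.toLp 2 (s • φ σ)
    have hinj : Set.InjOn v T := by
      intro σ hσ τ hτ h
      by_contra hne
      have h1 := hsep σ hσ τ hτ hne
      have h2 : dist (v σ) (v τ) = 0 := by rw [h, dist_self]
      exact absurd (hε.trans h1) (by rw [h2]; exact lt_irrefl 0)
    refine (hM (EuclideanSpace ℝ I) (T.image v) ?_ ?_ ?_).trans (measureReal_mono ?_)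
    · intro y hy
      obtain ⟨σ, -, rfl⟩ := Finset.mem_image.1 hy
      exact norm_toLp_smul_le hφ hIB σ
    · intro y hy y' hy' hne
      obtain ⟨σ, hσ, rfl⟩ := Finset.mem_image.1 hy
      obtain ⟨τ, hτ, rfl⟩ := Finset.mem_image.1 hy'
      exact hsep σ hσ τ hτ fun h => hne (by rw [h])
    · rwa [Finset.card_image_of_injOn hinj]
    · rintro w ⟨y, hy, hw⟩
      obtain ⟨σ, hσ, rfl⟩ := Finset.mem_image.1 hy
      exact ⟨σ, hσ, hw⟩

/-! ### Almost sure uniqueness of the minimizer -/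

section UniqueMinimizer

variable {I S : Type*} [Fintype I]

/-- Along a coordinate `i` with `c i ≠ 0` the hyperplane meets each line in at most one point, which
`P` does not charge. Integrating this coordinate first gives the claim. -/
theorem ae_pi_sum_mul_ne_zero {P : Measure ℝ} [IsProbabilityMeasure P] [NullSingletonClass P] {c : I → ℝ}
    (hc : c ≠ 0) : ∀ᵐ x ∂(Measure.pi fun _ : I => P), ∑ b, x b * c b ≠ 0 := by
  classical
  obtain ⟨i, hi⟩ := Function.ne_iff.1 hc
  have hm : MeasurableSet {x : I → ℝ | ∑ b, x b * c b = 0} :=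
    measurableSet_eq_fun (by fun_prop) (by fun_prop)
  have hslice : ∀ x : I → ℝ, ∫⁻ y, {x : I → ℝ | ∑ b, x b * c b = 0}.indicator 1
      (Function.update x i y) ∂P = (0 : ℝ≥0∞) := by
    intro x
    have hsub : {y : ℝ | ∑ b, Function.update x i y b * c b = 0}.Subsingleton := by
      intro y hy z hz
      simp only [Set.mem_ofPred_eq] at hy hz
      rw [← hz, ← sub_eq_zero, ← Finset.sum_sub_distrib,
        Finset.sum_eq_single i (fun b _ hb => by simp [Function.update_of_ne hb])
          (fun h => absurd (Finset.mem_univ i) h), Function.update_self, Function.update_self,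
        ← sub_mul] at hy
      exact sub_eq_zero.1 ((mul_eq_zero.1 hy).resolve_right hi)
    have hmy : MeasurableSet {y : ℝ | ∑ b, Function.update x i y b * c b = 0} :=
      hsub.measurableSet
    exact (lintegral_indicator_one hmy).trans (hsub.measure_zero P)
  rw [ae_iff]
  simp only [ne_eq, not_not]
  rw [← lintegral_indicator_one hm, lintegral_eq_lmarginal_univ (0 : I → ℝ),
    lmarginal_erase' _ (measurable_one.indicator hm) (Finset.mem_univ i)]
  simp only [hslice]
  simp [lmarginal]

theorem ae_existsUnique_isMinimizer_linearEnergy [Finite S] [Nonempty S] {P : Measure ℝ}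
    [IsProbabilityMeasure P] [NullSingletonClass P] {φ : S → I → ℝ} (hφ : Function.Injective φ) :
    RandomMinimization.HasUniqueMinimizer P (linearEnergy φ) := by
  have := Fintype.ofFinite S
  have h : ∀ᵐ x ∂(Measure.pi fun _ : I => P), ∀ σ τ, σ ≠ τ →
      ∑ b, x b * (φ σ - φ τ) b ≠ 0 := by
    refine ae_all_iff.2 fun σ => ae_all_iff.2 fun τ => ?_
    by_cases hne : σ = τ
    · exact ae_of_all _ fun x h => absurd hne h
    · filter_upwards [ae_pi_sum_mul_ne_zero (P := P) (sub_ne_zero.2 (hφ.ne hne))] with x hx _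
      exact hx
  filter_upwards [h] with x hx
  obtain ⟨σ, hσ⟩ := Finite.exists_min (linearEnergy φ x)
  refine ⟨σ, hσ, fun τ hτ => ?_⟩
  by_contra hne
  refine hx τ σ hne ?_
  have heq := le_antisymm (hτ σ) (hσ τ)
  simp only [linearEnergy, neg_inj] at heq
  simp only [Pi.sub_apply, mul_sub, Finset.sum_sub_distrib, heq, sub_self]

theorem RandomMinimization.HasRegularDensity.nullSingletonClass {P : Measure ℝ}
    (hP : RandomMinimization.HasRegularDensity P) : NullSingletonClass P := by
  obtain ⟨f, -, -, rfl, -⟩ := hP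
  infer_instance

end UniqueMinimizer

/-! ### The effect of replacing a block of coordinates -/

section ReplaceBlock

open RandomMinimization

variable {I S : Type*} [Fintype I]

/-- Regrouped as i.i.d. pairs, the replacement selects one entry of each pair, by a rule that
depends only on the index. -/
theorem measurePreserving_replaceBlock (P : Measure ℝ) [IsProbabilityMeasure P] (J : Set I) :
    MeasurePreserving (fun p : (I → ℝ) × (I → ℝ) => replaceBlock J p.1 p.2)
      ((Measure.pi fun _ => P).prod (Measure.pi fun _ => P)) (Measure.pi fun _ => P) := by
  classical
  have h1 := (measurePreserving_arrowProdEquivProdArrow ℝ ℝ I (fun _ => P) (fun _ => P)).symm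
  have h2 : MeasurePreserving (fun (z : I → ℝ × ℝ) i => (if i ∈ J then Prod.snd else Prod.fst) (z i))
      (Measure.pi fun _ => P.prod P) (Measure.pi fun _ => P) := by
    refine measurePreserving_pi _ _ fun i => ?_
    split_ifs
    · exact measurePreserving_snd
    · exact measurePreserving_fst
  convert! h2.comp h1 using 1
  ext p i
  simp only [replaceBlock, Function.comp_apply]
  split_ifs <;> rfl

theorem hasLaw_replaceBlock {Ω : Type*} [MeasurableSpace Ω] {μ : Measure Ω}
    [IsProbabilityMeasure μ] {P : Measure ℝ} [IsProbabilityMeasure P] {X X' : Ω → I → ℝ}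
    (hX : HasLaw X (Measure.pi fun _ => P) μ) (hX' : HasLaw X' (Measure.pi fun _ => P) μ)
    (hind : IndepFun X X' μ) (J : Set I) :
    HasLaw (fun ω => replaceBlock J (X ω) (X' ω)) (Measure.pi fun _ => P) μ := by
  have h : HasLaw (fun ω => (X ω, X' ω)) ((Measure.pi fun _ => P).prod (Measure.pi fun _ => P)) μ :=
    ⟨hX.aemeasurable.prodMk hX'.aemeasurable, by
      rw [(indepFun_iff_map_prod_eq_prod_map_map hX.aemeasurable hX'.aemeasurable).1 hind,
        hX.map_eq, hX'.map_eq]⟩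
  exact (measurePreserving_replaceBlock P J).hasLaw.comp h

open Classical in
/-- The total change of the coordinates in the block `J`. -/
noncomputable def blockChange (J : Set I) (x x' : I → ℝ) : ℝ := ∑ b with b ∈ J, |x b - x' b|

theorem blockChange_nonneg (J : Set I) (x x' : I → ℝ) : 0 ≤ blockChange J x x' :=
  Finset.sum_nonneg fun _ _ => abs_nonneg _

theorem abs_linearEnergy_replaceBlock_sub_le {φ : S → I → ℝ} (hφ : ∀ σ b, |φ σ b| ≤ 1) (J : Set I)
    (x x' : I → ℝ) (σ : S) :
    |linearEnergy φ x σ - linearEnergy φ (replaceBlock J x x') σ| ≤ blockChange J x x' := by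
  classical
  have h : linearEnergy φ x σ - linearEnergy φ (replaceBlock J x x') σ =
      ∑ b with b ∈ J, (x' b - x b) * φ σ b := by
    simp only [linearEnergy]
    rw [neg_sub_neg, ← Finset.sum_sub_distrib, Finset.sum_filter]
    refine Finset.sum_congr rfl fun b _ => ?_
    simp only [replaceBlock]
    split_ifs <;> ring
  rw [h, blockChange]
  refine (Finset.abs_sum_le_sum_abs _ _).trans (Finset.sum_le_sum fun b _ => ?_)
  rw [abs_mul, abs_sub_comm]
  exact mul_le_of_le_one_right (abs_nonneg _) (hφ σ b)

/-- The factor `2` pays for changing the disorder once in the energy of `σ` and once in that of `τ`.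
-/
theorem linearEnergy_le_of_isMinimizer_replaceBlock {φ : S → I → ℝ} (hφ : ∀ σ b, |φ σ b| ≤ 1)
    {J : Set I} {x x' : I → ℝ} {σ : S}
    (hσ : IsMinimizer (linearEnergy φ (replaceBlock J x x')) σ) (τ : S) :
    linearEnergy φ x σ ≤ linearEnergy φ x τ + 2 * blockChange J x x' := by
  have h1 := abs_le.1 (abs_linearEnergy_replaceBlock_sub_le hφ J x x' σ)
  have h2 := abs_le.1 (abs_linearEnergy_replaceBlock_sub_le hφ J x x' τ)
  linarith [hσ τ]

theorem lintegral_abs_eval {Ω : Type*} [MeasurableSpace Ω] {μ : Measure Ω} {P : Measure ℝ}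
    [IsProbabilityMeasure P] {X : Ω → I → ℝ} (hX : HasLaw X (Measure.pi fun _ => P) μ) (b : I) :
    ∫⁻ ω, ENNReal.ofReal |X ω b| ∂μ = ∫⁻ x, ENNReal.ofReal |x| ∂P := by
  have hm : Measurable fun x : ℝ => ENNReal.ofReal |x| := measurable_id.abs.ennreal_ofReal
  have hmb : Measurable fun x : I → ℝ => ENNReal.ofReal |x b| := hm.comp (measurable_pi_apply b)
  have h := (measurePreserving_eval (fun _ : I => P) b).lintegral_comp hm
  rw [← h, ← hX.map_eq]
  exact (lintegral_map' hmb.aemeasurable hX.aemeasurable).symm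

theorem aemeasurable_blockChange {Ω : Type*} [MeasurableSpace Ω] {μ : Measure Ω}
    {X X' : Ω → I → ℝ} (hX : AEMeasurable X μ) (hX' : AEMeasurable X' μ) (J : Set I) :
    AEMeasurable (fun ω => blockChange J (X ω) (X' ω)) μ := by
  have h : Measurable fun p : (I → ℝ) × (I → ℝ) => blockChange J p.1 p.2 := by
    unfold blockChange
    exact Finset.measurable_sum _ fun b _ => Measurable.abs (by fun_prop)
  exact h.comp_aemeasurable (hX.prodMk hX')

theorem lintegral_blockChange_le {Ω : Type*} [MeasurableSpace Ω] {μ : Measure Ω}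
    {P : Measure ℝ} [IsProbabilityMeasure P] {X X' : Ω → I → ℝ}
    (hX : HasLaw X (Measure.pi fun _ => P) μ) (hX' : HasLaw X' (Measure.pi fun _ => P) μ)
    {J : Set I} {c : ℕ} (hJ : J.ncard ≤ c) :
    ∫⁻ ω, ENNReal.ofReal (blockChange J (X ω) (X' ω)) ∂μ ≤
      c * (2 * ∫⁻ x, ENNReal.ofReal |x| ∂P) := by
  classical
  have hXb : ∀ b, AEMeasurable (fun ω => ENNReal.ofReal |X ω b|) μ := fun b =>
    ((measurable_pi_apply b).comp_aemeasurable hX.aemeasurable).norm.ennreal_ofReal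
  have hXb' : ∀ b, AEMeasurable (fun ω => ENNReal.ofReal |X' ω b|) μ := fun b =>
    ((measurable_pi_apply b).comp_aemeasurable hX'.aemeasurable).norm.ennreal_ofReal
  have hle : ∀ ω, ENNReal.ofReal (blockChange J (X ω) (X' ω)) ≤
      ∑ b with b ∈ J, (ENNReal.ofReal |X ω b| + ENNReal.ofReal |X' ω b|) := by
    intro ω
    rw [blockChange, ENNReal.ofReal_sum_of_nonneg fun _ _ => abs_nonneg _]
    refine Finset.sum_le_sum fun b _ => ?_
    rw [← ENNReal.ofReal_add (abs_nonneg _) (abs_nonneg _)]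
    exact ENNReal.ofReal_le_ofReal (abs_sub _ _)
  refine (lintegral_mono hle).trans ?_
  have hXX : ∀ b, AEMeasurable (fun ω => ENNReal.ofReal |X ω b| + ENNReal.ofReal |X' ω b|) μ :=
    fun b => (hXb b).add (hXb' b)
  rw [lintegral_finsetSum' _ fun b _ => hXX b]
  simp_rw [lintegral_add_left' (hXb _), lintegral_abs_eval hX, lintegral_abs_eval hX', ← two_mul]
  rw [Finset.sum_const, nsmul_eq_mul]
  gcongr
  rw [← Set.ncard_coe_finset, Finset.coe_filter]
  simpa using hJ

end ReplaceBlock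

/-! ### Trimming the exceptional labels -/

section Trimming

open RandomMinimization

/-- If a nonnegative quantity has average at most `ε * K`, then its value is at most `K` for more
than a proportion `1 - ε` of all labels. -/
theorem lt_card_filter_le {L : Type*} [Fintype L] {g : L → ℝ} (hg : ∀ l, 0 ≤ g l) {ε K : ℝ}
    (hK : 0 < K) (hsum : ∑ l, g l < ε * Fintype.card L * K) :
    (1 - ε) * Fintype.card L < ((Finset.univ.filter fun l => g l ≤ K).card : ℝ) := by
  classical
  have h1 : ((Finset.univ.filter fun l => ¬ g l ≤ K).card : ℝ) * K ≤ ∑ l, g l := by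
    rw [← nsmul_eq_mul]
    refine (Finset.card_nsmul_le_sum _ g K fun l hl => ?_).trans
      (Finset.sum_le_sum_of_subset_of_nonneg (Finset.filter_subset _ _) fun l _ _ => hg l)
    exact (not_le.1 (Finset.mem_filter.1 hl).2).le
  have h2 := lt_of_mul_lt_mul_right (h1.trans_lt hsum) hK.le
  have h3 := Finset.card_filter_add_card_filter_not (s := (Finset.univ : Finset L))
    (fun l => g l ≤ K)
  rw [Finset.card_univ] at h3
  have h4 : ((Finset.univ.filter fun l => g l ≤ K).card : ℝ) +
      ((Finset.univ.filter fun l => ¬ g l ≤ K).card : ℝ) = Fintype.card L := by exact_mod_cast h3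
  linarith

/-- The trimmed packing number is an infimum over label sets, so a lower bound on it applies to any
admissible `A` of choice. -/
theorem exists_separated_of_le_trimmedPackingNumber {L S : Type*} [Fintype L] [Finite S]
    [PseudoMetricSpace S] {ε : ℝ≥0} {o : L → S} {M : ℕ} (hM : M ≤ trimmedPackingNumber ε o)
    {A : Finset L} (hA : (1 - (ε : ℝ)) * Fintype.card L < A.card) :
    ∃ T : Finset S, M ≤ T.card ∧ (∀ σ ∈ T, ∃ l ∈ A, o l = σ) ∧
      ∀ σ ∈ T, ∀ τ ∈ T, σ ≠ τ → (ε : ℝ) < dist σ τ := by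
  have h1 : (M : ℕ∞) ≤ Metric.packingNumber ε (o '' (A : Set L)) := hM.trans (iInf₂_le A hA)
  have htop : Metric.packingNumber ε (o '' (A : Set L)) ≠ ⊤ :=
    ((Metric.packingNumber_le_encard_self _).trans_lt (Set.toFinite _).encard_lt_top).ne
  obtain ⟨C, hCA, hfin, hsep, hcard⟩ := Metric.exists_set_encard_eq_packingNumber htop
  refine ⟨hfin.toFinset, ?_, ?_, ?_⟩
  · rw [← hcard, hfin.encard_eq_coe_toFinset_card] at h1
    exact_mod_cast h1
  · intro σ hσ
    obtain ⟨l, hl, rfl⟩ := hCA (hfin.mem_toFinset.1 hσ)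
    exact ⟨l, hl, rfl⟩
  · intro σ hσ τ hτ hne
    have h2 : (ε : ℝ≥0∞) < edist σ τ := hsep (hfin.mem_toFinset.1 hσ) (hfin.mem_toFinset.1 hτ) hne
    rw [edist_nndist, ENNReal.coe_lt_coe] at h2
    exact_mod_cast h2

end Trimming

/-! ### Lattice geometry and stability of the Edwards–Anderson model -/

namespace EdwardsAnderson

variable {d : ℕ}

instance (Λ : Box d) : Finite (SpinConfig Λ) :=
  Finite.of_injective SpinConfig.spin fun _ _ h => SpinConfig.ext h

instance (Λ : Box d) : Nonempty (SpinConfig Λ) := ⟨⟨fun _ => 1, rfl⟩⟩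

theorem abs_bondSpin_le_one {Λ : Box d} (σ : SpinConfig Λ) (b : Bond Λ) : |bondSpin σ b| ≤ 1 := by
  obtain ⟨e, he⟩ := b
  induction e with
  | h i j =>
    simp only [bondSpin, Sym2.lift_mk]
    rcases Int.units_eq_one_or (σ.spin i) with h | h <;>
      rcases Int.units_eq_one_or (σ.spin j) with h' | h' <;> simp [h, h']

theorem dist_eq_dist_toLp {Λ : Box d} (σ τ : SpinConfig Λ) :
    dist σ τ = dist (WithLp.toLp 2 (√(1 / (Λ.sites.card : ℝ)) • bondSpin σ))
      (WithLp.toLp 2 (√(1 / (Λ.sites.card : ℝ)) • bondSpin τ)) := by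
  rw [WithLp.toLp_smul, WithLp.toLp_smul, dist_smul₀, Real.norm_eq_abs,
    abs_of_nonneg (Real.sqrt_nonneg _)]
  exact bondDist_eq_mul_dist σ τ

/-- A bond at `i` is determined by its other endpoint, which lies in the cube of side `3` around
`i`. This crude count suffices, since any bound independent of the region will do. -/
theorem ncard_siteBlock_le (Λ : Box d) (i : Site Λ) : (siteBlock Λ i).ncard ≤ 3 ^ d := by
  classical
  let g : Bond Λ → Fin d → ℤ := fun b => if h : i ∈ b.1 then (Sym2.Mem.other h).1 else 0
  have hmaps : ∀ b ∈ siteBlock Λ i, g b ∈ (Finset.Icc (i.1 - 1) (i.1 + 1) : Finset (Fin d → ℤ)) := by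
    intro b hb
    have hb' : i ∈ b.1 := hb
    have hadj : Λ.graph.Adj i (Sym2.Mem.other hb') := by
      rw [← SimpleGraph.mem_edgeSet, Sym2.other_spec]
      exact b.2
    have hsum : ∑ k, |i.1 k - (Sym2.Mem.other hb').1 k| = 1 := hadj
    have hk : ∀ k, |i.1 k - (Sym2.Mem.other hb').1 k| ≤ 1 := fun k => by
      rw [← hsum]
      exact Finset.single_le_sum (f := fun k => |i.1 k - (Sym2.Mem.other hb').1 k|)
        (fun _ _ => abs_nonneg _) (Finset.mem_univ k)
    simp only [g, hb', dif_pos, Finset.mem_Icc, Pi.le_def, Pi.sub_apply, Pi.add_apply, Pi.one_apply]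
    exact ⟨fun k => by linarith [(abs_le.1 (hk k)).2], fun k => by linarith [(abs_le.1 (hk k)).1]⟩
  have hinj : Set.InjOn g (siteBlock Λ i) := by
    intro b hb c hc h
    have hb' : i ∈ b.1 := hb
    have hc' : i ∈ c.1 := hc
    simp only [g, hb', hc', dif_pos] at h
    refine Subtype.ext ?_
    rw [← Sym2.other_spec hb', ← Sym2.other_spec hc', Subtype.ext h]
  have hle := Set.ncard_le_ncard_of_injOn g (t := ((Finset.Icc (i.1 - 1) (i.1 + 1) :
    Finset (Fin d → ℤ)) : Set (Fin d → ℤ))) hmaps hinj (Finset.finite_toSet _)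
  rw [Set.ncard_coe_finset, Pi.card_Icc] at hle
  refine hle.trans_eq ?_
  simp only [Int.card_Icc, Pi.add_apply, Pi.sub_apply, Pi.one_apply]
  rw [Finset.prod_congr rfl fun k _ => show (i.1 k + 1 + 1 - (i.1 k - 1)).toNat = 3 by
    rw [show i.1 k + 1 + 1 - (i.1 k - 1) = 3 by ring]; rfl]
  simp

theorem card_bond_le (Λ : Box d) : Fintype.card (Bond Λ) ≤ Λ.sites.card * 3 ^ d := by
  classical
  have hcover : (Finset.univ : Finset (Bond Λ)) ⊆
      Finset.univ.biUnion fun i : Site Λ => (siteBlock Λ i).toFinset := by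
    rintro ⟨e, he⟩ -
    induction e with
    | h i j =>
      refine Finset.mem_biUnion.2 ⟨i, Finset.mem_univ i, Set.mem_toFinset.2 ?_⟩
      exact Sym2.mem_mk_left i j
  refine (Finset.card_le_card hcover).trans ((Finset.card_biUnion_le_card_mul _ _ (3 ^ d)
    fun i _ => ?_).trans_eq ?_)
  · rw [← Set.ncard_eq_toFinset_card']
    exact ncard_siteBlock_le Λ i
  · simp

/-- A walk from the origin to a second site begins with a bond. This makes the set of single-bond
labels nonempty for large regions. -/
theorem nonempty_bond (Λ : Box d) (h : 1 < Λ.sites.card) : Nonempty (Bond Λ) := by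
  obtain ⟨j, hj, hne⟩ := Finset.exists_mem_ne h 0
  obtain ⟨w⟩ := Λ.connected.preconnected ⟨0, Λ.zero_mem⟩ ⟨j, hj⟩
  cases w with
  | nil => exact absurd rfl hne
  | cons hadj _ => exact ⟨⟨s(_, _), (SimpleGraph.mem_edgeSet _).2 hadj⟩⟩

theorem card_bond_mul_sq_le (Λ : Box d) :
    (Fintype.card (Bond Λ) : ℝ) * √(1 / (Λ.sites.card : ℝ)) ^ 2 ≤ 3 ^ d := by
  have hpos : (0 : ℝ) < Λ.sites.card := by exact_mod_cast card_sites_pos Λ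
  have h : (Fintype.card (Bond Λ) : ℝ) ≤ Λ.sites.card * 3 ^ d := by exact_mod_cast card_bond_le Λ
  rw [Real.sq_sqrt (by positivity), mul_one_div, div_le_iff₀ hpos, mul_comm]
  linarith

open RandomMinimization

/-- The Edwards–Anderson model is stable under replacing blocks of bounded size. -/
theorem stableUnderSmallPerturbations_of_ncard_le.{v} (Λ : ℕ → Box d) {P : Measure ℝ}
    [IsProbabilityMeasure P] (hP : HasRegularDensity P) (hint : Integrable (fun x : ℝ => x) P)
    {L : ℕ → Type} [∀ n, Fintype (L n)] (hL : ∀ᶠ n in atTop, Nonempty (L n))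
    (J : ∀ n, L n → Set (Bond (Λ n))) {c : ℕ} (hJ : ∀ n l, (J n l).ncard ≤ c) :
    StableUnderSmallPerturbations.{v} P (fun n => hamiltonian (Λ n)) J := by
  intro Ω _ μ _ X X' opt hX hX' hind hopt ε δ hε hδ
  have hκ : ∫⁻ x, ENNReal.ofReal |x| ∂P ≠ ⊤ := hint.abs.lintegral_lt_top.ne
  obtain ⟨a, ha⟩ : ∃ a : ℝ≥0, (c * (2 * ∫⁻ x, ENNReal.ofReal |x| ∂P) : ℝ≥0∞) = a :=
    ⟨_, (ENNReal.coe_toNNReal (ENNReal.mul_ne_top (ENNReal.natCast_ne_top c)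
      (ENNReal.mul_ne_top ENNReal.ofNat_ne_top hκ))).symm⟩
  -- The mean change of a block is at most `a`. With this `K`, Markov's inequality bounds by `δ / 2`
  -- the probability that the average change reaches `ε * K`; the summand `1` keeps `K` positive if
  -- `a = 0`.
  let K : ℝ≥0 := 2 * a / (ε * δ) + 1
  have hK : 0 < K := by positivity
  have haK : a ≤ ε * K * (δ / 2) := by
    have h1 : ε * K * (δ / 2) = a + ε * δ / 2 := by
      simp only [K]
      field_simp
    rw [h1]
    exact le_self_add
  obtain ⟨M, hM⟩ := exists_measure_isSeparatedNearMinimal_le hP hint (B := 3 ^ d) (ε := ε)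
    (K := 2 * K) (η := δ / 2) (by positivity) (by exact_mod_cast hε) (by positivity)
    (by positivity)
  refine ⟨M, limsup_le_of_le (h := ?_)⟩
  filter_upwards [hL] with n hn
  set s := √(1 / ((Λ n).sites.card : ℝ))
  set φ : SpinConfig (Λ n) → Bond (Λ n) → ℝ := bondSpin
  set G := {x | ∃ T : Finset (SpinConfig (Λ n)), M ≤ T.card ∧
    IsSeparatedNearMinimal φ s ε (2 * K) x T}
  have hGm : MeasurableSet G := measurableSet_isSeparatedNearMinimal φ s ε (2 * K) M
  have hG : (Measure.pi fun _ => P) G ≤ ENNReal.ofReal (δ / 2) :=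
    hM _ _ φ s abs_bondSpin_le_one (Real.sqrt_nonneg _) (card_bond_mul_sq_le (Λ n))
  let g : L n → Ω n → ℝ := fun l ω => blockChange (J n l) (X n ω) (X' n l ω)
  have hgm : ∀ l, AEMeasurable (fun ω => ENNReal.ofReal (g l ω)) (μ n) := fun l =>
    (aemeasurable_blockChange (hX n).aemeasurable (hX' n l).aemeasurable (J n l)).ennreal_ofReal
  have hLpos : 0 < Fintype.card (L n) := Fintype.card_pos
  let t : ℝ≥0 := ε * Fintype.card (L n) * K
  have ht : 0 < t := by positivity
  have hbad : μ n {ω | (t : ℝ≥0∞) ≤ ∑ l, ENNReal.ofReal (g l ω)} ≤ ENNReal.ofReal (δ / 2) := by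
    have h1 := mul_meas_ge_le_lintegral₀ (Finset.aemeasurable_fun_sum Finset.univ
      fun l _ => hgm l) (t : ℝ≥0∞)
    have h2 : ∫⁻ ω, ∑ l, ENNReal.ofReal (g l ω) ∂(μ n) ≤ (Fintype.card (L n) * a : ℝ≥0) := by
      rw [lintegral_finsetSum' _ fun l _ => hgm l]
      refine (Finset.sum_le_sum fun l _ =>
        (lintegral_blockChange_le (hX n) (hX' n l) (hJ n l)).trans_eq ha).trans ?_
      simp
    have h3 : (Fintype.card (L n) * a : ℝ≥0) ≤ t * (δ / 2) := by
      calc (Fintype.card (L n) * a : ℝ≥0) ≤ Fintype.card (L n) * (ε * K * (δ / 2)) := by gcongr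
        _ = t * (δ / 2) := by simp only [t]; ring
    have h4 : ENNReal.ofReal (δ / 2) = ((δ / 2 : ℝ≥0) : ℝ≥0∞) := by
      rw [← ENNReal.ofReal_coe_nnreal]; simp
    have h5 := h1.trans (h2.trans (ENNReal.coe_le_coe.2 h3))
    rw [ENNReal.coe_mul] at h5
    rw [h4]
    exact (ENNReal.mul_le_mul_iff_right (by exact_mod_cast ht.ne') ENNReal.coe_ne_top).1 h5
  -- The optimizer is controlled only at almost every input; this is enough because each replaced
  -- input has the same law as the original one.
  have hmin : ∀ᵐ ω ∂(μ n), ∀ l, IsMinimizer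
      (linearEnergy φ (replaceBlock (J n l) (X n ω) (X' n l ω)))
      (opt n (replaceBlock (J n l) (X n ω) (X' n l ω))) := by
    refine ae_all_iff.2 fun l => ?_
    have hlaw := hasLaw_replaceBlock (hX n) (hX' n l) (hind n l) (J n l)
    have h1 := hopt n
    rw [← hlaw.map_eq] at h1
    exact ae_of_ae_map hlaw.aemeasurable h1
  have hsub : {ω | (M : ℕ∞) ≤ trimmedPackingNumber ε
      (fun l : L n => opt n (replaceBlock (J n l) (X n ω) (X' n l ω)))} ≤ᵐ[μ n]
      (X n ⁻¹' G ∪ {ω | (t : ℝ≥0∞) ≤ ∑ l, ENNReal.ofReal (g l ω)} : Set (Ω n)) := by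
    filter_upwards [hmin] with ω hω hMω
    by_cases hb : (t : ℝ≥0∞) ≤ ∑ l, ENNReal.ofReal (g l ω)
    · exact Or.inr hb
    left
    have hg0 : ∀ l, 0 ≤ g l ω := fun l => blockChange_nonneg _ _ _
    rw [not_le, ← ENNReal.ofReal_sum_of_nonneg fun l _ => hg0 l, ← ENNReal.ofReal_coe_nnreal,
      ENNReal.ofReal_lt_ofReal_iff (by exact_mod_cast ht)] at hb
    -- The labels kept are those whose block changes by at most `K`. Their minimizers are within `2
    -- * K` of the minimum for the unperturbed input.
    have hA := lt_card_filter_le hg0 (ε := ε) (K := K) (by exact_mod_cast hK)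
      (by simpa [t] using hb)
    obtain ⟨T, hTM, hTA, hTsep⟩ := exists_separated_of_le_trimmedPackingNumber hMω hA
    refine ⟨T, hTM, fun σ hσ τ hτ hne => ?_, fun σ hσ τ => ?_⟩
    · rw [← dist_eq_dist_toLp]
      exact hTsep σ hσ τ hτ hne
    · obtain ⟨l, hl, rfl⟩ := hTA σ hσ
      have h1 := linearEnergy_le_of_isMinimizer_replaceBlock abs_bondSpin_le_one (hω l) τ
      have h2 : g l ω ≤ K := (Finset.mem_filter.1 hl).2
      simp only [g] at h2
      linarith
  refine (measure_mono_ae hsub).trans ((measure_union_le _ _).trans ?_)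
  have hXG : μ n (X n ⁻¹' G) = (Measure.pi fun _ => P) G := by
    rw [← (hX n).map_eq, Measure.map_apply_of_aemeasurable (hX n).aemeasurable hGm]
  rw [hXG]
  refine (add_le_add hG hbad).trans_eq ?_
  rw [← ENNReal.ofReal_add (by positivity) (by positivity), add_halves, ENNReal.ofReal_coe_nnreal]

end EdwardsAnderson

theorem mainTheorem11 (d : ℕ) (Λ : ℕ → EdwardsAnderson.Box d)
    (hΛ : Tendsto (fun n => (Λ n).sites.card) atTop atTop)
    (P : Measure ℝ) [IsProbabilityMeasure P]
    (hP : RandomMinimization.HasRegularDensity P)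
    (hint : Integrable (fun x : ℝ => x) P) (hmean : ∫ x : ℝ, x ∂P = 0) :
    (∀ n, RandomMinimization.HasUniqueMinimizer P (EdwardsAnderson.hamiltonian (Λ n))) ∧
    RandomMinimization.StableUnderSmallPerturbations.{u} P
      (fun n => EdwardsAnderson.hamiltonian (Λ n))
      (fun n => EdwardsAnderson.bondBlock (Λ n)) ∧
    RandomMinimization.StableUnderSmallPerturbations.{u} P
      (fun n => EdwardsAnderson.hamiltonian (Λ n))
      (fun n => EdwardsAnderson.siteBlock (Λ n)) := by
  have := hP.nullSingletonClass
  refine ⟨fun n => ae_existsUnique_isMinimizer_linearEnergy EdwardsAnderson.bondSpin_injective,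
    EdwardsAnderson.stableUnderSmallPerturbations_of_ncard_le Λ hP hint ?_ _ (c := 1) fun n b => ?_,
    EdwardsAnderson.stableUnderSmallPerturbations_of_ncard_le Λ hP hint ?_ _
      fun n => EdwardsAnderson.ncard_siteBlock_le (Λ n)⟩
  · filter_upwards [hΛ.eventually_gt_atTop 1] with n hn
    exact EdwardsAnderson.nonempty_bond (Λ n) hn
  · exact (Set.ncard_singleton b).le
  · exact Eventually.of_forall fun n => ⟨⟨0, (Λ n).zero_mem⟩⟩
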